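/- Let $n\ge 1$ and let $\alpha=(\alpha_2,\alpha_3,\dots)$ be a finitely supported sequence of non-negative integers. A *minimal factorization of type $\alpha$* of the $n$-cycle $(1\,2\,\dots\,n)$ is a sequence of cycles $\sigma_1,\dots,\sigma_m\in S_n$ of lengths at least $2$ with $\sigma_m\cdots\sigma_1=(1\,2\,\dots\,n)$ (products are composed from right to left), containing exactly $\alpha_j$ cycles of length $j$ for each $j\ge2$, where $\sum_{j\ge2}(j-1)\alpha_j=n-1$. Two factorizations are *equivalent* if one is obtained from the other by repeatedly interchanging neighbouring factors that commute. Let $\mathcal T_{n,\alpha}$ be the set of undirected plane trees, rooted at a leaf (considered up to isomorphism of rooted plane trees), that have $2n$ leaves (vertices of degree $1$, the root included), $\alpha_j$ vertices of degree $2j$ for each $j\ge 2$, and no other vertices. *The plane graph of a product.* To $\sigma_m\cdots\sigma_1$ associate the following directed graph with a counterclockwise order of the edges at each vertex. Its vertices are leaves $t_1,\dots,t_n,h_1,\dots,h_n$ and one vertex for each factor $\sigma_i$. For each $k$ there is a directed path of edges labelled $k$ which starts at $t_k$, passes through the vertices of those factors that move $k$, in the order $\sigma_1,\sigma_2,\dots$,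 and ends at $h_k$. At the vertex of a factor $(k_1\,k_2\,\dots\,k_j)$ the counterclockwise order is: outgoing $k_1$, incoming $k_1$, outgoing $k_2$, incoming $k_2$, …, outgoing $k_j$, incoming $k_j$. *Stripping a tree.* Given a tree in $\mathcal T_{n,\alpha}$, label its leaves $h_1,t_1,h_2,t_2,\dots,h_n,t_n$ counterclockwise, starting with the root. Choose, for some $j$, a remaining internal vertex of degree $2j$ with $j$ adjacent $t$-leaves; the labels of these leaves, read counterclockwise around the vertex, form a cycle, which is the next factor (in the order $\sigma_1,\sigma_2,\dots$). Remove the vertex; its edges to leaves are removed, and its edges to other vertices are cut in half, each of the new leaves so created inheriting the label of the leaf that followed the cut edge counterclockwise at the removed vertex. Repeat until no internal vertex is left. **Theorem.** Sending a minimal factorization of type $\alpha$ to the undirected plane graph of its product, rooted at $h_1$, induces a well-defined bijection from the set of equivalence classes of minimal factorizations of type $\alpha$ of $(1\,2\,\dots\,n)$ onto $\mathcal T_{n,\alpha}$. Its inverse is given by stripping: for every tree in $\mathcal T_{n,\alpha}$, whatever choices are made, as long as an internal vertex is left there is one that can be removed, and the factors that have been read off when none is left form a minimal factorization of type $\alpha$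 in the equivalence class that corresponds to the tree. -/

import Mathlib

/-! ### Minimal factorizations of a long cycle, up to commutation -/

/-- The rank `⟨α⟩ = ∑_{j ≥ 2} (j - 1) α_j` (the indices `0` and `1` contribute nothing). -/
def typeRank (α : ℕ →₀ ℕ) : ℕ := α.sum fun j a => (j - 1) * a

/-- The list `[σ₁, …, σₘ]` is a minimal factorization `σₘ ⋯ σ₁` of type `α` of the cycle
`(0 1 … n-1)`: every factor is a cycle (of length at least two), exactly `α j` of them are
`j`-cycles for each `j ≥ 2`, and `⟨α⟩ = n - 1`. The factors are listed in the order in which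
they are applied. -/
structure IsMinimalFactorization (n : ℕ) (α : ℕ →₀ ℕ) (l : List (Equiv.Perm (Fin n))) :
    Prop where
  isCycle : ∀ σ ∈ l, σ.IsCycle
  prod_eq : l.reverse.prod = finRotate n
  type_eq : ∀ j, 2 ≤ j → l.countP (fun σ => σ.support.card = j) = α j
  minimal : typeRank α + 1 = n

/-- Minimal factorizations of type `α` of `(0 1 … n-1)`. -/
abbrev MinimalFactorization (n : ℕ) (α : ℕ →₀ ℕ) : Type :=
  {l : List (Equiv.Perm (Fin n)) // IsMinimalFactorization n α l}

/-- `l'` is obtained from `l` by interchanging two neighbouring factors that commute. -/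
def CommutationMove {n : ℕ} (l l' : List (Equiv.Perm (Fin n))) : Prop :=
  ∃ (a b : List (Equiv.Perm (Fin n))) (σ τ : Equiv.Perm (Fin n)),
    Commute σ τ ∧ l = a ++ σ :: τ :: b ∧ l' = a ++ τ :: σ :: b

/-- Equivalence of factorizations: they differ only in the order of commuting factors. -/
def factorizationSetoid (n : ℕ) (α : ℕ →₀ ℕ) : Setoid (MinimalFactorization n α) where
  r l l' := Relation.EqvGen CommutationMove l.1 l'.1
  iseqv :=
    ⟨fun l => Relation.EqvGen.refl l.1, fun h => Relation.EqvGen.symm _ _ h,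
      fun h h' => Relation.EqvGen.trans _ _ _ h h'⟩

/-- Inequivalent minimal factorizations of type `α`. -/
abbrev InequivalentFactorization (n : ℕ) (α : ℕ →₀ ℕ) : Type :=
  Quotient (factorizationSetoid n α)

/-! ### The directed plane graph of a product of cycles -/

/-- The half-edges of the directed plane graph of the product `σₘ ⋯ σ₁`, `l = [σ₁, …, σₘ]`.
There is one vertex for each factor, and there are leaves `t_k` and `h_k` for each `k`.
`tail k` and `head k` are the half-edges at the leaves `t_k` and `h_k`; `inc i k` and `out i k`
are the incoming and the outgoing half-edge labelled `k` at the vertex of the `i`-th factor,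
where `k` runs through the elements of that cycle. -/
inductive ProductDart {n : ℕ} (l : List (Equiv.Perm (Fin n))) : Type
  | tail (k : Fin n) : ProductDart l
  | head (k : Fin n) : ProductDart l
  | inc (i : Fin l.length) (k : Fin n) (hk : l.get i k ≠ k) : ProductDart l
  | out (i : Fin l.length) (k : Fin n) (hk : l.get i k ≠ k) : ProductDart l

namespace ProductDart

variable {n : ℕ} {l : List (Equiv.Perm (Fin n))}

/-- The next half-edge in counterclockwise order at the same vertex. At the vertex of a cycle
`(k₁ k₂ … kⱼ)` the order is: outgoing `k₁`, incoming `k₁`, outgoing `k₂`, incoming `k₂`, …. -/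
def rot : ProductDart l → ProductDart l
  | tail k => tail k
  | head k => head k
  | out i k hk => inc i k hk
  | inc i k hk => out i (l.get i k) (fun h => hk ((l.get i).injective h))

/-- The directed edges: for each label `k` there is a directed path of edges labelled `k` that
starts at `t_k`, passes through the vertices of the factors that move `k`, in the order in which
they are applied, and ends at `h_k`. -/
inductive Arrow : ProductDart l → ProductDart l → Prop
  | tail_head (k : Fin n) (h : ∀ r, l.get r k = k) : Arrow (tail k) (head k)
  | tail_inc (j : Fin l.length) (k : Fin n) (hj : l.get j k ≠ k)
      (h : ∀ r, r < j → l.get r k = k) : Arrow (tail k) (inc j k hj)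
  | out_inc (i j : Fin l.length) (k : Fin n) (hi : l.get i k ≠ k) (hj : l.get j k ≠ k)
      (hij : i < j) (h : ∀ r, i < r → r < j → l.get r k = k) : Arrow (out i k hi) (inc j k hj)
  | out_head (i : Fin l.length) (k : Fin n) (hi : l.get i k ≠ k)
      (h : ∀ r, i < r → l.get r k = k) : Arrow (out i k hi) (head k)

end ProductDart

/-! ### Plane trees rooted at a leaf -/

/-- A plane tree rooted at a leaf. The root leaf itself is not recorded: `T` describes what hangs
below it, so `node c f` is the vertex adjacent to the root leaf, its further neighbours being the
tops of `f 0, …, f (c - 1)`, in counterclockwise order after the edge to the root. -/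
inductive PlantedTree : Type
  | node (c : ℕ) (f : Fin c → PlantedTree) : PlantedTree

namespace PlantedTree

/-- The number of vertices of degree `d` of the tree, other than the root leaf. A vertex with `c`
children has degree `c + 1`. -/
def vertexCount (d : ℕ) : PlantedTree → ℕ
  | node c f => (if c + 1 = d then 1 else 0) + ∑ i, vertexCount d (f i)

/-- The tree has `2n` leaves (the root is one of them), `α j` vertices of degree `2j` for each
`j ≥ 2`, and no other vertices. -/
structure HasType (n : ℕ) (α : ℕ →₀ ℕ) (T : PlantedTree) : Prop where
  leaves : T.vertexCount 1 + 1 = 2 * n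
  internal : ∀ j, 2 ≤ j → T.vertexCount (2 * j) = α j
  only : ∀ d, T.vertexCount d ≠ 0 → d = 1 ∨ ∃ j, 2 ≤ j ∧ d = 2 * j

/-- The vertices of the tree other than the root leaf: `none` is the top vertex, and
`some ⟨i, v⟩` is the vertex `v` of the `i`-th subtree. -/
def Vertex : PlantedTree → Type
  | node c f => Option (Σ i : Fin c, Vertex (f i))

/-- The neighbour of the root leaf. -/
def top : (T : PlantedTree) → T.Vertex
  | node _ _ => none

/-- The half-edges of the tree. Each vertex `v` other than the root leaf has an edge to its
parent; `up v` is the half of this edge at `v`, and `down v` its half at the parent of `v`. -/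
inductive Dart (T : PlantedTree) : Type
  | up (v : T.Vertex) : Dart T
  | down (v : T.Vertex) : Dart T

/-- The half-edge at the root leaf. -/
def rootDart (T : PlantedTree) : T.Dart := .down T.top

/-- The other half of the same edge. -/
def opp {T : PlantedTree} : T.Dart → T.Dart
  | .up v => .down v
  | .down v => .up v

/-- The half-edges of the `i`-th subtree (the half-edge at its root leaf included) as half-edges
of the whole tree. -/
def liftDart {c : ℕ} {f : Fin c → PlantedTree} (i : Fin c) : (f i).Dart → (node c f).Dart
  | .up v => .up (some ⟨i, v⟩ : Option (Σ i : Fin c, (f i).Vertex))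
  | .down v => .down (some ⟨i, v⟩ : Option (Σ i : Fin c, (f i).Vertex))

/-- The half-edge at the top vertex towards its `i`-th child if `i < c`; the one towards the root
leaf if `i = c`. -/
def topDart (c : ℕ) (f : Fin c → PlantedTree) (i : ℕ) : (node c f).Dart :=
  if h : i < c then liftDart ⟨i, h⟩ (f ⟨i, h⟩).rootDart else .up (node c f).top

open Classical in
/-- The next half-edge in counterclockwise order at the same vertex: the half-edge to the parent
is followed by those to the children in their order, and then by the one to the parent again.
At the root leaf there is only one half-edge. -/
noncomputable def rot : (T : PlantedTree) → T.Dart → T.Dart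
  | node c f, .up none => topDart c f 0
  | node _ _, .down none => .down none
  | node _ f, .up (some ⟨i, v⟩) => liftDart i (rot (f i) (.up v))
  | node c f, .down (some ⟨i, v⟩) =>
    if v = (f i).top then topDart c f (i + 1) else liftDart i (rot (f i) (.down v))

/-- The leaves other than the root leaf, in the counterclockwise order starting from the root. -/
def leaves : (T : PlantedTree) → List T.Vertex
  | node 0 _ => [none]
  | node (c + 1) f => (List.finRange (c + 1)).flatMap fun i =>
      (leaves (f i)).map fun v => (some ⟨i, v⟩ : Option (Σ i : Fin (c + 1), (f i).Vertex))

/-- `T`, with the leaf `h₀` as its root, is the undirected plane graph of the product `σₘ ⋯ σ₁`,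
`l = [σ₁, …, σₘ]`: there is a bijection of the half-edges that respects the counterclockwise order
around every vertex, the edges, and the root. -/
def IsTreeOfProduct {n : ℕ} [NeZero n] (T : PlantedTree) (l : List (Equiv.Perm (Fin n))) : Prop :=
  ∃ φ : ProductDart l ≃ T.Dart,
    (∀ d, φ d.rot = T.rot (φ d)) ∧
    (∀ d d', (d.Arrow d' ∨ d'.Arrow d) ↔ opp (φ d) = φ d') ∧
    φ (.head 0) = T.rootDart

/-! ### Stripping a tree -/

/-- The half-edges at the vertex that carries `d`. -/
def star {T : PlantedTree} (d : T.Dart) : Set T.Dart := {e | ∃ r : ℕ, T.rot^[r] d = e}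

/-- A stage of the stripping procedure: `gone` is the set of half-edges at the vertices that have
been removed, and `lab e k` says that the edge of the half-edge `e` now leads from its vertex to a
`t`-leaf labelled `k` (an original leaf or one created by cutting an edge). Only the half-edges at
the internal vertices that remain matter. -/
structure Stage (n : ℕ) (T : PlantedTree) : Type where
  gone : Set T.Dart
  lab : T.Dart → Fin n → Prop

/-- At the beginning the leaves are labelled `h₀, t₀, h₁, t₁, …` counterclockwise, starting with
the root. The list `T.leaves` omits the root, so `t_k` stands at its place `2k`. -/
def initialStage (n : ℕ) (T : PlantedTree) : Stage n T where
  gone := ∅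
  lab e k := ∃ v, T.leaves[2 * (k : ℕ)]? = some v ∧ opp e = .up v

namespace Stage

variable {n : ℕ} {T : PlantedTree}

/-- The vertex of `d` is an internal vertex that has not been removed yet; for some `j` its degree
is `2j` and it has `j` adjacent `t`-leaves. -/
def Removable (s : Stage n T) (d : T.Dart) : Prop :=
  d ∉ s.gone ∧ T.rot d ≠ d ∧
    ∃ j, (star d).ncard = 2 * j ∧ {e | e ∈ star d ∧ ∃ k, s.lab e k}.ncard = j

/-- `σ` is the cycle formed by the labels of the `t`-leaves adjacent to the vertex of `d`, read
counterclockwise: it sends the label of each of them to the label of the next one, and fixes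
all other labels. -/
def IsFactor (s : Stage n T) (d : T.Dart) (σ : Equiv.Perm (Fin n)) : Prop :=
  (∀ e ∈ star d, ∀ k, s.lab e k →
    ∃ r, 1 ≤ r ∧ s.lab (T.rot^[r] e) (σ k) ∧
      ∀ q, 1 ≤ q → q < r → ∀ k', ¬ s.lab (T.rot^[q] e) k') ∧
  ∀ k, (∀ e ∈ star d, ¬ s.lab e k) → σ k = k

/-- Remove the vertex of `d`. An edge from it to another vertex is cut; the leaf so created at the
other vertex takes the label of the leaf that followed the edge counterclockwise at the removed
vertex. -/
def remove (s : Stage n T) (d : T.Dart) : Stage n T where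
  gone := s.gone ∪ star d
  lab e k := (opp e ∈ star d ∧ s.lab (T.rot (opp e)) k) ∨ (opp e ∉ star d ∧ s.lab e k)

/-- All internal vertices have been removed. -/
def Complete (s : Stage n T) : Prop := ∀ d, T.rot d ≠ d → d ∈ s.gone

/-- `Run s l s'`: removing vertices one after another leads from `s` to `s'`, and the cycles read
off are those of the list `l`, in this order. -/
inductive Run : Stage n T → List (Equiv.Perm (Fin n)) → Stage n T → Prop
  | nil (s : Stage n T) : Run s [] s
  | cons (s s' : Stage n T) (d : T.Dart) (σ : Equiv.Perm (Fin n)) (l : List (Equiv.Perm (Fin n)))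
      (hd : s.Removable d) (hσ : s.IsFactor d σ) (hl : Run (s.remove d) l s') : Run s (σ :: l) s'

end Stage

end PlantedTree

/-! A product of cycles and a plane tree are both treated as a set of half-edges with a rotation and
an edge involution. The main tool is the face walk, which crosses an edge and then turns to the next
half-edge counterclockwise until it meets a leaf.

In the map of a product, the walk from h_k runs back along the path labelled k to t_k, while the
walk from t_k applies the factors one after another and ends at the h-leaf of the image of k
(`nextLeaf_head`, `nextLeaf_tail`). Since the product is the long cycle, these walks link all leaves
and the map is connected. Minimality says exactly that there is one vertex more than there are edges
(`card_vertices`), so the map is a plane tree (`exists_dartEquiv`). Two commuting neighbouring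
factors with a common point would be joined by two edges, which a tree forbids; hence they are
disjoint, and interchanging them does not change the map.

For surjectivity, the even degrees allow the half-edges of a tree to be coloured as incoming and
outgoing, with a height growing along the edges (`exists_isColoring`). The label of an incoming
half-edge is the t-leaf at which its face walk ends. Label and height determine the half-edge
(`eq_of_nextLeaf`), so the labels around an internal vertex are distinct and form a cycle. Listing
these cycles by height reproduces the directed paths and hence the tree
(`exists_dartEquiv_of_isLabelCycle`); the walk of the tree from t_k to the next h-leaf shows that
their product is the long cycle.

Injectivity and the description of the inverse come from stripping. The invariant `Stripped` says
that the incoming half-edge labelled k at a remaining factor leads to a t-leaf exactly when all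
earlier factors moving k are gone. So a vertex is removable exactly when no earlier remaining factor
shares a label with it, its cycle is the original factor, and the earlier remaining factors commute
with it. Every complete run thus returns an equivalent factorization, and the run in the original
order returns the factorization itself; so factorizations with the same tree are equivalent. -/

/-! ### Walking around the face of a plane map -/

namespace PlaneMap

variable {D : Type*} {rot opp : D → D}

/-- `NextLeaf rot opp e z`: the walk along the face that leaves through the half-edge `e` meets
its first leaf at the half-edge `z`. -/
inductive NextLeaf (rot opp : D → D) : D → D → Prop
  | arrive (e : D) (h : rot (opp e) = opp e) : NextLeaf rot opp e (opp e)
  | go (e z : D) (h : rot (opp e) ≠ opp e) (hz : NextLeaf rot opp (rot (opp e)) z) :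
      NextLeaf rot opp e z

theorem NextLeaf.unique {e z z' : D} (h : NextLeaf rot opp e z) (h' : NextLeaf rot opp e z') :
    z = z' := by
  induction h with
  | arrive e he =>
    cases h' with
    | arrive => rfl
    | go _ _ h _ => exact absurd he h
  | go e z he _ ih =>
    cases h' with
    | arrive _ h => exact absurd h he
    | go _ _ _ h => exact ih h

theorem NextLeaf.of_ne {e z : D} (h : NextLeaf rot opp e z) (he : rot (opp e) ≠ opp e) :
    NextLeaf rot opp (rot (opp e)) z := by
  cases h with
  | arrive _ h' => exact absurd h' he
  | go _ _ _ h' => exact h'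

theorem NextLeaf.rot_eq {e z : D} (h : NextLeaf rot opp e z) : rot z = z := by
  induction h with
  | arrive e he => exact he
  | go _ _ _ _ ih => exact ih

/-- Injectivity keeps a half-edge that the rotation moves from becoming a leaf in the image. -/
theorem NextLeaf.map {D' : Type*} {rot' opp' : D' → D'} {g : D → D'}
    (hg : Function.Injective g) (hr : ∀ d, g (rot d) = rot' (g d))
    (ho : ∀ d, g (opp d) = opp' (g d)) {e z : D} (h : NextLeaf rot opp e z) :
    NextLeaf rot' opp' (g e) (g z) := by
  induction h with
  | arrive e he => rw [ho]; exact .arrive _ (by rw [← ho, ← hr, he])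
  | go e z he _ ih =>
    refine .go _ _ ?_ ?_
    · rw [← ho, ← hr]; exact fun h => he (hg h)
    · rw [← ho, ← hr]; exact ih

/-- The walk along the face that leaves through `e` meets the leaves of the list `L` and then
continues as if it left through `e'`. -/
def Leads (rot opp : D → D) (e : D) (L : List D) (e' : D) : Prop :=
  ∀ M, List.IsChain (NextLeaf rot opp) (e' :: M) → List.IsChain (NextLeaf rot opp) (e :: (L ++ M))

theorem Leads.trans {e e' e'' : D} {L L' : List D} (h : Leads rot opp e L e')
    (h' : Leads rot opp e' L' e'') : Leads rot opp e (L ++ L') e'' := fun M hM => by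
  rw [List.append_assoc]; exact h _ (h' M hM)

theorem leads_go {e : D} (h : rot (opp e) ≠ opp e) : Leads rot opp e [] (rot (opp e)) := by
  intro M hM
  cases M with
  | nil => simp
  | cons z M =>
    rw [List.isChain_cons_cons] at hM
    simp only [List.nil_append, List.isChain_cons_cons]
    exact ⟨.go _ _ h hM.1, hM.2⟩

theorem leads_arrive {e : D} (h : rot (opp e) = opp e) : Leads rot opp e [opp e] (opp e) := by
  intro M hM
  exact List.isChain_cons_cons.2 ⟨.arrive _ h, hM⟩

theorem Leads.refl (e : D) : Leads rot opp e [] e := fun _ h => h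

theorem leads_flatMap {c : ℕ} (e : ℕ → D) (L : Fin c → List D)
    (h : ∀ i : Fin c, Leads rot opp (e i) (L i) (e (i + 1))) :
    Leads rot opp (e 0) ((List.finRange c).flatMap L) (e c) := by
  induction c generalizing e with
  | zero => exact Leads.refl _
  | succ c ih =>
    rw [List.finRange_succ, List.flatMap_cons, List.flatMap_map]
    refine (h 0).trans ?_
    exact ih (fun j => e (j + 1)) (fun i => L i.succ) fun i => h i.succ

end PlaneMap

/-! ### Half-edges of a tree in terms of its subtrees -/

namespace PlantedTree

open PlaneMap

theorem opp_opp {T : PlantedTree} (x : T.Dart) : opp (opp x) = x := by cases x <;> rfl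

section node

variable {c : ℕ} {f : Fin c → PlantedTree}

theorem opp_liftDart (i : Fin c) (x : (f i).Dart) :
    opp (liftDart (f := f) i x) = liftDart i (opp x) := by cases x <;> rfl

theorem liftDart_inj {i j : Fin c} {x : (f i).Dart} {y : (f j).Dart}
    (h : liftDart (f := f) i x = liftDart j y) : i = j ∧ x ≍ y := by
  cases x <;> cases y <;> simp only [liftDart] at h <;> cases h <;> exact ⟨rfl, .rfl⟩

theorem liftDart_injective (i : Fin c) : Function.Injective (liftDart (f := f) i) :=
  fun _ _ h => eq_of_heq (liftDart_inj h).2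

theorem liftDart_ne_rootDart (i : Fin c) (x : (f i).Dart) :
    liftDart i x ≠ (node c f).rootDart := by
  intro h; cases x <;> cases h

theorem liftDart_ne_up_top (i : Fin c) (x : (f i).Dart) :
    liftDart i x ≠ .up (node c f).top := by
  intro h; cases x <;> cases h

/-- A vertex of the `i`-th subtree as a vertex of the whole tree. -/
def liftVertex (i : Fin c) (v : (f i).Vertex) : (node c f).Vertex :=
  (some ⟨i, v⟩ : Option (Σ i : Fin c, (f i).Vertex))

theorem leaves_node_zero (f : Fin 0 → PlantedTree) : (node 0 f).leaves = [(node 0 f).top] := rfl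

theorem leaves_node_succ (f : Fin (c + 1) → PlantedTree) :
    (node (c + 1) f).leaves =
      (List.finRange (c + 1)).flatMap fun i => (f i).leaves.map (liftVertex i) := rfl

theorem dart_cases {P : (node c f).Dart → Prop} (hroot : P (node c f).rootDart)
    (htop : P (.up (node c f).top)) (hlift : ∀ i x, P (liftDart i x)) (x) : P x := by
  rcases x with (_ | ⟨i, v⟩) | (_ | ⟨i, v⟩)
  · exact htop
  · exact hlift i (.up v)
  · exact hroot
  · exact hlift i (.down v)

theorem rot_rootDart (T : PlantedTree) : T.rot T.rootDart = T.rootDart := by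
  cases T; rfl

theorem rot_up_top : (node c f).rot (.up (node c f).top) = topDart c f 0 := rfl

theorem rot_liftDart (i : Fin c) {x : (f i).Dart} (hx : x ≠ (f i).rootDart) :
    (node c f).rot (liftDart i x) = liftDart i ((f i).rot x) := by
  cases x with
  | up v => rfl
  | down v =>
    have : v ≠ (f i).top := fun h => hx (by rw [h]; rfl)
    exact if_neg this

theorem rot_liftDart_rootDart (i : Fin c) :
    (node c f).rot (liftDart i (f i).rootDart) = topDart c f (i + 1) := by
  exact if_pos rfl

theorem topDart_of_lt (i : Fin c) : topDart c f i = liftDart i (f i).rootDart := by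
  simp [topDart]

theorem topDart_self : topDart c f c = .up (node c f).top := by
  simp [topDart]

theorem topDart_injOn {i j : ℕ} (hi : i ≤ c) (hj : j ≤ c) (h : topDart c f i = topDart c f j) :
    i = j := by
  rcases hi.lt_or_eq with hi | rfl <;> rcases hj.lt_or_eq with hj | rfl
  · rw [topDart_of_lt ⟨i, hi⟩, topDart_of_lt ⟨j, hj⟩] at h
    simpa using (liftDart_inj h).1
  · rw [topDart_of_lt ⟨i, hi⟩, topDart_self] at h
    exact absurd h (liftDart_ne_up_top _ _)
  · rw [topDart_of_lt ⟨j, hj⟩, topDart_self] at h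
    exact absurd h.symm (liftDart_ne_up_top _ _)
  · rfl

theorem topDart_ne_rootDart (i : ℕ) : topDart c f i ≠ (node c f).rootDart := by
  unfold topDart
  split
  · exact liftDart_ne_rootDart _ _
  · simp [rootDart]

theorem rot_topDart {i : ℕ} (hi : i < c) :
    (node c f).rot (topDart c f i) = topDart c f (i + 1) := by
  rw [topDart_of_lt ⟨i, hi⟩, rot_liftDart_rootDart]

end node

/-! ### Trees inside a plane map -/

/-- The map `g` embeds the half-edges of `T` into a plane map such that edges and, except at the
root leaf, the counterclockwise orders around the vertices are respected. -/
structure IsLocal {D : Type*} (rot opp : D → D) {T : PlantedTree} (g : T.Dart → D) : Prop where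
  opp_map : ∀ x, opp (g x) = g (PlantedTree.opp x)
  rot_map : ∀ x, x ≠ T.rootDart → rot (g x) = g (T.rot x)
  injective : Function.Injective g

theorem isLocal_id (T : PlantedTree) : IsLocal T.rot opp (id : T.Dart → T.Dart) :=
  ⟨fun _ => rfl, fun _ _ => rfl, Function.injective_id⟩

namespace IsLocal

variable {D : Type*} {rot opp : D → D}

theorem lift {c : ℕ} {f : Fin c → PlantedTree} {g : (node c f).Dart → D}
    (hg : IsLocal rot opp g) (i : Fin c) : IsLocal rot opp (g ∘ liftDart i) where
  opp_map x := by simp [hg.opp_map, opp_liftDart]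
  rot_map x hx := by
    simp [hg.rot_map _ (liftDart_ne_rootDart i x), rot_liftDart i hx]
  injective := hg.injective.comp (liftDart_injective i)

theorem rot_up_top {c : ℕ} {f : Fin c → PlantedTree} {g : (node c f).Dart → D}
    (hg : IsLocal rot opp g) : rot (g (.up (node c f).top)) = g (topDart c f 0) :=
  hg.rot_map _ (by simp [rootDart])

theorem rot_topDart {c : ℕ} {f : Fin c → PlantedTree} {g : (node c f).Dart → D}
    (hg : IsLocal rot opp g) {i : ℕ} (hi : i < c) :
    rot (g (topDart c f i)) = g (topDart c f (i + 1)) := by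
  rw [hg.rot_map _ (topDart_ne_rootDart i), PlantedTree.rot_topDart hi]

theorem iterate_rot_up_top {c : ℕ} {f : Fin c → PlantedTree} {g : (node c f).Dart → D}
    (hg : IsLocal rot opp g) {i : ℕ} (hi : i ≤ c) :
    rot^[i + 1] (g (.up (node c f).top)) = g (topDart c f i) := by
  induction i with
  | zero => exact hg.rot_up_top
  | succ i ih => rw [Function.iterate_succ_apply', ih (by omega), hg.rot_topDart hi]

/-- The iterates run through `topDart c f 0, …, topDart c f c`, which are distinct, and the last of
these is the starting half-edge again. -/
theorem minimalPeriod_up_top {c : ℕ} {f : Fin c → PlantedTree} {g : (node c f).Dart → D}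
    (hg : IsLocal rot opp g) :
    Function.minimalPeriod rot (g (.up (node c f).top)) = c + 1 := by
  have hp : Function.IsPeriodicPt rot (c + 1) (g (.up (node c f).top)) := by
    rw [Function.IsPeriodicPt, Function.IsFixedPt, hg.iterate_rot_up_top le_rfl, topDart_self]
  refine le_antisymm (hp.minimalPeriod_le (by omega)) ?_
  by_contra! h
  have h0 := hp.minimalPeriod_pos (by omega)
  have h1 := Function.iterate_minimalPeriod (f := rot) (x := g (.up (node c f).top))
  obtain ⟨m, hm⟩ : ∃ m, Function.minimalPeriod rot (g (.up (node c f).top)) = m + 1 :=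
    ⟨_, (Nat.succ_pred_eq_of_pos h0).symm⟩
  rw [hm, hg.iterate_rot_up_top (by omega), ← topDart_self] at h1
  have := topDart_injOn (by omega) le_rfl (hg.injective h1)
  omega

/-- The rotation period at the far end of the root edge gives the number of children, and the
iterates there are the root edges of the subtrees. So the ambient map and one half-edge determine
the tree recursively. -/
theorem tree_unique {T T' : PlantedTree} {g : T.Dart → D} {g' : T'.Dart → D}
    (hg : IsLocal rot opp g) (hg' : IsLocal rot opp g') (h : g T.rootDart = g' T'.rootDart) :
    T = T' := by
  induction T generalizing T' with
  | node c f ih =>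
    obtain ⟨c', f'⟩ := T'
    have ht : g (.up (node c f).top) = g' (.up (node c' f').top) := by
      have h1 := hg.opp_map (node c f).rootDart
      have h2 := hg'.opp_map (node c' f').rootDart
      rw [h, h2] at h1
      exact h1.symm
    have hc : c = c' := by
      have h1 := hg.minimalPeriod_up_top
      have h2 := hg'.minimalPeriod_up_top
      rw [ht, h2] at h1
      omega
    subst hc
    congr 1
    funext i
    refine ih i (hg.lift i) (hg'.lift i) ?_
    have h1 := hg.iterate_rot_up_top i.2.le
    have h2 := hg'.iterate_rot_up_top i.2.le
    rw [ht, h2, topDart_of_lt, topDart_of_lt] at h1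
    exact h1.symm

/-- The face walk is the depth-first traversal: it enters each subtree through its root edge,
returns through the same edge, and turns to the next child. -/
theorem leads {T : PlantedTree} {g : T.Dart → D} (hg : IsLocal rot opp g) :
    Leads rot opp (g T.rootDart) (T.leaves.map fun v => g (.up v)) (g (.up T.top)) := by
  induction T with
  | node c f ih =>
    have h0 : opp (g (node c f).rootDart) = g (.up (node c f).top) := hg.opp_map _
    cases c with
    | zero =>
      have := leads_arrive (rot := rot) (opp := opp) (e := g (node 0 f).rootDart)
        (by rw [h0, hg.rot_up_top, topDart_self])
      rw [h0] at this
      exact this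
    | succ c =>
      have h1 : Leads rot opp (g (node (c + 1) f).rootDart) [] (g (topDart (c + 1) f 0)) := by
        have := leads_go (rot := rot) (opp := opp) (e := g (node (c + 1) f).rootDart) (by
          rw [h0, hg.rot_up_top, ← topDart_self]
          exact fun h => by simpa using topDart_injOn (by omega) le_rfl (hg.injective h))
        rwa [h0, hg.rot_up_top] at this
      have h2 : ∀ i : Fin (c + 1), Leads rot opp (g (topDart (c + 1) f i))
          ((f i).leaves.map fun v => g (liftDart i (.up v))) (g (topDart (c + 1) f (i + 1))) := by
        intro i
        have h3 := ih i (hg.lift i)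
        have h4 : opp (g (liftDart i (.up (f i).top))) = g (topDart (c + 1) f i) := by
          rw [hg.opp_map, opp_liftDart, topDart_of_lt]; rfl
        have h5 := leads_go (rot := rot) (opp := opp) (e := g (liftDart i (.up (f i).top))) (by
          rw [h4, hg.rot_topDart i.2]
          exact fun h => by simpa using topDart_injOn (by omega) (by omega) (hg.injective h))
        rw [h4, hg.rot_topDart i.2] at h5
        have := h3.trans h5
        rw [List.append_nil] at this
        rwa [topDart_of_lt]
      have h3 := leads_flatMap (fun i => g (topDart (c + 1) f i)) _ h2
      have h4 := h1.trans h3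
      rw [topDart_self] at h4
      convert h4 using 1
      simp only [leaves_node_succ, List.map_flatMap, List.map_map, List.nil_append]
      rfl

end IsLocal

/-- The half-edges at the leaves, in counterclockwise order, starting with the root. -/
def leafDarts (T : PlantedTree) : List T.Dart := T.rootDart :: T.leaves.map .up

theorem isChain_leafDarts (T : PlantedTree) :
    List.IsChain (NextLeaf T.rot opp) (T.leafDarts ++ [T.rootDart]) := by
  have h := (isLocal_id T).leads
  refine h [T.rootDart] (List.isChain_cons_cons.2 ⟨?_, by simp⟩)
  exact .arrive _ (T.rot_rootDart)

theorem length_leaves (T : PlantedTree) : T.leaves.length = T.vertexCount 1 := by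
  induction T with
  | node c f ih =>
    cases c with
    | zero => simp [leaves_node_zero, vertexCount]
    | succ c =>
      simp [leaves_node_succ, vertexCount, List.length_flatMap, ih, Fin.sum_univ_def]

/-- Every half-edge at a leaf occurs in the list of these. -/
theorem mem_leafDarts {T : PlantedTree} {x : T.Dart} (hx : T.rot x = x) : x ∈ T.leafDarts := by
  induction T with
  | node c f ih =>
    induction x using dart_cases with
    | hroot => simp [leafDarts]
    | htop =>
      rw [rot_up_top, ← topDart_self] at hx
      obtain rfl : c = 0 := (topDart_injOn (by omega) le_rfl hx).symm
      simp [leafDarts, leaves_node_zero]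
    | hlift i x =>
      by_cases h : x = (f i).rootDart
      · rw [h, rot_liftDart_rootDart, ← topDart_of_lt] at hx
        exact absurd (topDart_injOn (by omega) (by omega) hx) (by omega)
      · rw [rot_liftDart i h] at hx
        have h1 := ih i (liftDart_injective i hx)
        simp only [leafDarts, List.mem_cons, h, false_or, List.mem_map] at h1 ⊢
        obtain ⟨v, hv, rfl⟩ := h1
        right
        obtain ⟨c, rfl⟩ : ∃ c', c = c' + 1 := ⟨c - 1, by have := i.2; omega⟩
        refine ⟨liftVertex i v, ?_, rfl⟩
        simp only [leaves_node_succ, List.mem_flatMap, List.mem_map]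
        exact ⟨i, List.mem_finRange i, v, hv, rfl⟩

end PlantedTree

/-! ### Connected plane maps and their levels -/

namespace PlaneMap

/-- A plane map with root `r` on the vertex set `W` is levelled by `up` and `lev` if on every edge
exactly one half-edge is `up`, namely the one at the endpoint of higher level, and every vertex
carries at most one of them. -/
structure IsLeveling {D W : Type*} (opp : D → D) (vtx : D → W) (r : D) (up : D → Prop)
    (lev : W → ℕ) : Prop where
  up_opp : ∀ d, up (opp d) ↔ ¬ up d
  lev_eq : ∀ d, up d → lev (vtx d) = lev (vtx (opp d)) + 1
  up_unique : ∀ d d', up d → up d' → vtx d = vtx d' → d = d'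
  lev_root : lev (vtx r) = 0

variable {D W : Type*} {rot opp : D → D} {vtx : D → W} {r : D}

/-- If exactly one of the two half-edges is upward, each endpoint would lie one level above the
other. If both or neither are, an endpoint carries two upward half-edges, which must coincide. -/
theorem IsLeveling.no_double_edge {up : D → Prop} {lev : W → ℕ}
    (h : IsLeveling opp vtx r up lev) (hopp : ∀ d, opp (opp d) = d) {d d' : D}
    (h1 : vtx d = vtx d') (h2 : vtx (opp d) = vtx (opp d')) : d = d' := by
  by_cases hd : up d <;> by_cases hd' : up d'
  · exact h.up_unique _ _ hd hd' h1
  · have h3 := h.lev_eq _ hd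
    have h4 := h.lev_eq _ ((h.up_opp d').2 hd')
    rw [hopp, ← h1, ← h2] at h4
    omega
  · have h3 := h.lev_eq _ hd'
    have h4 := h.lev_eq _ ((h.up_opp d).2 hd)
    rw [hopp, h1, h2] at h4
    omega
  · have := h.up_unique _ _ ((h.up_opp d).2 hd) ((h.up_opp d').2 hd') h2
    rw [← hopp d, this, hopp]

/-- The half-edges at one vertex form an orbit of the counterclockwise rotation, and the whole map
is connected. -/
structure IsConnectedMap (rot opp : D → D) (vtx : D → W) (r : D) : Prop where
  opp_opp : ∀ d, opp (opp d) = d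
  vtx_eq_iff : ∀ d d', vtx d = vtx d' ↔ ∃ m, rot^[m] d = d'
  vtx_surjective : Function.Surjective vtx
  connected : ∀ S : Set D, r ∈ S → (∀ d ∈ S, rot d ∈ S) → (∀ d ∈ S, opp d ∈ S) → ∀ d, d ∈ S

namespace IsConnectedMap

variable (h : IsConnectedMap rot opp vtx r)
include h

theorem vtx_rot (d : D) : vtx (rot d) = vtx d := ((h.vtx_eq_iff _ _).2 ⟨1, rfl⟩).symm

theorem vtx_iterate_rot (d : D) (m : ℕ) : vtx (rot^[m] d) = vtx d :=
  ((h.vtx_eq_iff _ _).2 ⟨m, rfl⟩).symm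

theorem mem_periodicPts (d : D) : d ∈ Function.periodicPts rot := by
  obtain ⟨m, hm⟩ := (h.vtx_eq_iff (rot d) d).1 (h.vtx_rot d)
  exact ⟨m + 1, by omega, hm⟩

theorem exists_level : ∃ lev : W → ℕ, lev (vtx r) = 0 ∧
    ∀ w, w ≠ vtx r → ∃ d, vtx d = w ∧ lev w = lev (vtx (opp d)) + 1 := by
  classical
  -- The endpoints of walks of exactly m edges from the root vertex; the level is the least such m,
  -- that is, the distance.
  let P : ℕ → Set W := fun m => (fun s => {w | ∃ d, vtx d = w ∧ vtx (opp d) ∈ s})^[m] {vtx r}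
  have hP_succ : ∀ m, P (m + 1) = {w | ∃ d, vtx d = w ∧ vtx (opp d) ∈ P m} := fun m =>
    Function.iterate_succ_apply' _ _ _
  have hP : ∀ w, ∃ m, w ∈ P m := by
    intro w
    obtain ⟨d, rfl⟩ := h.vtx_surjective w
    refine h.connected {d | ∃ m, vtx d ∈ P m} ⟨0, rfl⟩ ?_ ?_ d
    · rintro d ⟨m, hm⟩
      exact ⟨m, by rwa [h.vtx_rot]⟩
    · rintro d ⟨m, hm⟩
      refine ⟨m + 1, ?_⟩
      rw [hP_succ]
      exact ⟨opp d, rfl, by rwa [h.opp_opp]⟩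
  refine ⟨fun w => Nat.find (hP w), ?_, ?_⟩
  · exact (Nat.find_eq_zero (hP (vtx r))).2 rfl
  · intro w hw
    have h1 := Nat.find_spec (hP w)
    obtain ⟨m, hm⟩ : ∃ m, Nat.find (hP w) = m + 1 := by
      refine Nat.exists_eq_succ_of_ne_zero fun h0 => hw ?_
      rw [h0] at h1
      exact h1
    rw [hm, hP_succ] at h1
    obtain ⟨d, hd, hd'⟩ := h1
    refine ⟨d, hd, le_antisymm ?_ ?_⟩
    · refine Nat.find_min' _ ?_
      rw [hP_succ]
      exact ⟨d, hd, Nat.find_spec (hP (vtx (opp d)))⟩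
    · beta_reduce; rw [hm]
      exact Nat.succ_le_succ (Nat.find_min' _ hd')

/-- Each vertex other than the root chooses a half-edge towards a vertex one level lower. The chosen
half-edges and their opposites are 2(|W| - 1) distinct ones, so by the count there are no others. -/
theorem exists_isLeveling [Fintype D] [Fintype W]
    (hcard : 2 * Fintype.card W = Fintype.card D + 2) :
    ∃ up lev, IsLeveling opp vtx r up lev := by
  classical
  obtain ⟨lev, h0, hlev⟩ := h.exists_level
  choose p hp hpl using fun w : {w // w ≠ vtx r} => hlev w.1 w.2
  have hne : ∀ w w', p w ≠ opp (p w') := by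
    intro w w' hw
    have h1 := hpl w
    have h2 := hpl w'
    rw [← hw, hp] at h2
    rw [hw, h.opp_opp, hp] at h1
    omega
  let q : {w // w ≠ vtx r} × Bool → D := fun x => if x.2 then p x.1 else opp (p x.1)
  have hopp_inj : Function.Injective opp := fun a b hab => by rw [← h.opp_opp a, hab, h.opp_opp]
  have hp_inj : Function.Injective p := fun a b hab => Subtype.ext (by rw [← hp a, hab, hp])
  have hq : Function.Injective q := by
    rintro ⟨w, _ | _⟩ ⟨w', _ | _⟩ hww
    · exact congrArg (·, false) (hp_inj (hopp_inj hww))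
    · exact absurd hww.symm (hne _ _)
    · exact absurd hww (hne _ _)
    · exact congrArg (·, true) (hp_inj hww)
  have hq' : Function.Surjective q := by
    refine ((Fintype.bijective_iff_injective_and_card q).2 ⟨hq, ?_⟩).2
    rw [Fintype.card_prod, Fintype.card_bool, Fintype.card_subtype_compl, Fintype.card_subtype_eq]
    omega
  refine ⟨fun d => d ∈ Set.range p, lev, ?_, ?_, ?_, h0⟩
  · intro d
    obtain ⟨⟨w, _ | _⟩, rfl⟩ := hq' d
    · simp only [q, Bool.false_eq_true, if_false, h.opp_opp]
      refine ⟨fun _ ⟨w', hw'⟩ => hne _ _ hw', fun _ => ⟨w, rfl⟩⟩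
    · simp only [q, if_true]
      exact ⟨fun ⟨w', hw'⟩ => absurd hw' (hne _ _), fun hw => absurd ⟨w, rfl⟩ hw⟩
  · rintro _ ⟨w, rfl⟩
    rw [hp, hpl]
  · rintro _ _ ⟨w, rfl⟩ ⟨w', rfl⟩ hw
    rw [hp, hp] at hw
    rw [Subtype.ext hw]

end IsConnectedMap

end PlaneMap

/-! ### Unfolding a levelled map into a plane tree -/

namespace PlantedTree

open PlaneMap

/-- The map on the half-edges of `node c f` with given values at the two half-edges of the root
edge and given restrictions to the subtrees. -/
def nodeMap {X : Type*} {c : ℕ} {f : Fin c → PlantedTree} (a b : X) (g : ∀ i, (f i).Dart → X) :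
    (node c f).Dart → X
  | .up none => b
  | .down none => a
  | .up (some ⟨i, v⟩) => g i (.up v)
  | .down (some ⟨i, v⟩) => g i (.down v)

section nodeMap

variable {X : Type*} {c : ℕ} {f : Fin c → PlantedTree} (a b : X) (g : ∀ i, (f i).Dart → X)

@[simp] theorem nodeMap_rootDart : nodeMap a b g (node c f).rootDart = a := rfl

@[simp] theorem nodeMap_up_top : nodeMap a b g (.up (node c f).top) = b := rfl

@[simp] theorem nodeMap_liftDart (i : Fin c) (x) : nodeMap a b g (liftDart i x) = g i x := by
  cases x <;> rfl

end nodeMap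

theorem opp_up_top (T : PlantedTree) : opp (.up T.top) = T.rootDart := rfl

theorem isLocal_nodeMap {D : Type*} {rot oppD : D → D} {c : ℕ} {f : Fin c → PlantedTree}
    {d : D} {g : ∀ i, (f i).Dart → D} (hopp : ∀ d, oppD (oppD d) = d)
    (hg : ∀ i, IsLocal rot oppD (g i)) (hroot : ∀ i, g i (f i).rootDart = rot^[i + 1] (oppD d))
    (hper : rot^[c + 1] (oppD d) = oppD d)
    (hinj : Function.Injective (nodeMap d (oppD d) g)) :
    IsLocal rot oppD (nodeMap d (oppD d) g) := by
  have htop : ∀ i ≤ c, nodeMap d (oppD d) g (topDart c f i) = rot^[i + 1] (oppD d) := by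
    intro i hi
    rcases hi.lt_or_eq with hi | rfl
    · rw [topDart_of_lt ⟨i, hi⟩, nodeMap_liftDart, hroot]
    · rw [topDart_self, nodeMap_up_top, hper]
  refine ⟨fun x => ?_, fun x hx => ?_, hinj⟩
  · induction x using dart_cases with
    | hroot => rfl
    | htop => simp [opp_up_top, hopp]
    | hlift i x => rw [opp_liftDart, nodeMap_liftDart, nodeMap_liftDart, (hg i).opp_map]
  · induction x using dart_cases with
    | hroot => exact absurd rfl hx
    | htop => rw [rot_up_top, htop 0 (by omega)]; rfl
    | hlift i x =>
      by_cases h : x = (f i).rootDart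
      · rw [h, rot_liftDart_rootDart, htop _ i.2, nodeMap_liftDart, hroot,
          ← Function.iterate_succ_apply' rot]
      · rw [rot_liftDart i h, nodeMap_liftDart, nodeMap_liftDart, (hg i).rot_map _ h]

/-- The tree beyond a downward half-edge is built by recursion: the other half-edges at the far
endpoint all point down again and are the root edges of the subtrees. The recursion ends because
levels are bounded. -/
theorem exists_isLocal {D W : Type*} [Fintype W] {rot opp : D → D} {vtx : D → W}
    {r : D} {up : D → Prop} {lev : W → ℕ} (h : IsConnectedMap rot opp vtx r)
    (hl : IsLeveling opp vtx r up lev) {d : D} (hd : ¬ up d) :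
    ∃ (T : PlantedTree) (g : T.Dart → D), IsLocal rot opp g ∧ g T.rootDart = d := by
  classical
  -- One step towards the root: an upward half-edge goes to its opposite, a downward one to the
  -- upward half-edge at its vertex. Where such a step exists, `Lev` drops by exactly one.
  let anc : D → D := fun e =>
    if up e then opp e else if h : ∃ e', up e' ∧ vtx e' = vtx e then h.choose else e
  let Lev : D → ℕ := fun e => 2 * lev (vtx e) + if up e then 0 else 1
  -- The ancestor clause is what gives injectivity: a half-edge in the images of two subtrees would
  -- reach both of their root half-edges after the same number of steps, so these coincide.
  suffices ∀ k d, ¬ up d → Finset.univ.sup lev - lev (vtx d) = k →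
      ∃ (T : PlantedTree) (g : T.Dart → D), IsLocal rot opp g ∧ g T.rootDart = d ∧
        ∀ x, ∃ m, anc^[m] (g x) = d ∧ Lev (g x) = Lev d + m by
    obtain ⟨T, g, h1, h2, -⟩ := this _ d hd rfl
    exact ⟨T, g, h1, h2⟩
  intro k
  induction k using Nat.strong_induction_on with
  | _ k ih =>
    intro d hd hk
    have hup : up (opp d) := (hl.up_opp d).2 hd
    have hlev : lev (vtx (opp d)) = lev (vtx d) + 1 := by
      have := hl.lev_eq _ hup
      rwa [h.opp_opp] at this
    have hle : lev (vtx (opp d)) ≤ Finset.univ.sup lev := Finset.le_sup (Finset.mem_univ _)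
    obtain ⟨c, hc⟩ : ∃ c, Function.minimalPeriod rot (opp d) = c + 1 :=
      Nat.exists_eq_succ_of_ne_zero
        (Function.minimalPeriod_pos_of_mem_periodicPts (h.mem_periodicPts _)).ne'
    have hinj : ∀ i j, i ≤ c → j ≤ c → rot^[i] (opp d) = rot^[j] (opp d) → i = j := by
      intro i j hi hj hij
      exact Function.iterate_injOn_Iio_minimalPeriod (f := rot) (x := opp d)
        (by simp only [Set.mem_Iio]; omega) (by simp only [Set.mem_Iio]; omega) hij
    have hdown : ∀ i : Fin c, ¬ up (rot^[i + 1] (opp d)) := by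
      intro i hi
      have := hinj (i + 1) 0 (by omega) (by omega)
        (hl.up_unique _ _ hi hup (h.vtx_iterate_rot _ _))
      omega
    have hanc1 : anc (opp d) = d := by simp only [anc, if_pos hup, h.opp_opp]
    have hanc2 : ∀ i : Fin c, anc (rot^[i + 1] (opp d)) = opp d := by
      intro i
      have hex : ∃ e', up e' ∧ vtx e' = vtx (rot^[i + 1] (opp d)) :=
        ⟨opp d, hup, (h.vtx_iterate_rot _ _).symm⟩
      simp only [anc, if_neg (hdown i), dif_pos hex]
      exact hl.up_unique _ _ hex.choose_spec.1 hup
        (hex.choose_spec.2.trans (h.vtx_iterate_rot _ _))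
    have hLev1 : Lev (opp d) = Lev d + 1 := by
      simp only [Lev, if_pos hup, if_neg hd, hlev]; omega
    have hLev2 : ∀ i : Fin c, Lev (rot^[i + 1] (opp d)) = Lev d + 2 := by
      intro i
      simp only [Lev, if_neg (hdown i), if_neg hd, h.vtx_iterate_rot, hlev]; omega
    choose f g hg hgroot hganc using fun i : Fin c =>
      ih (Finset.univ.sup lev - lev (vtx (rot^[i + 1] (opp d))))
        (by rw [h.vtx_iterate_rot]; omega) (rot^[i + 1] (opp d)) (hdown i) rfl
    have hgLev : ∀ i x, Lev d + 2 ≤ Lev (g i x) := by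
      intro i x
      obtain ⟨m, -, hm⟩ := hganc i x
      rw [hm, hLev2]; omega
    refine ⟨node c f, nodeMap d (opp d) g, ?_, rfl, ?_⟩
    · refine isLocal_nodeMap h.opp_opp hg hgroot
        (by rw [← hc]; exact Function.iterate_minimalPeriod) ?_
      intro x y hxy
      induction x using dart_cases with
      | hroot =>
        induction y using dart_cases with
        | hroot => rfl
        | htop => have := congrArg Lev hxy; simp [hLev1] at this
        | hlift j y => have h1 := congrArg Lev hxy; have := hgLev j y; simp at h1; omega
      | htop =>
        induction y using dart_cases with
        | hroot => have := congrArg Lev hxy; simp [hLev1] at this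
        | htop => rfl
        | hlift j y => have h1 := congrArg Lev hxy; have := hgLev j y; simp [hLev1] at h1; omega
      | hlift i x =>
        induction y using dart_cases with
        | hroot => have h1 := congrArg Lev hxy; have := hgLev i x; simp at h1; omega
        | htop => have h1 := congrArg Lev hxy; have := hgLev i x; simp [hLev1] at h1; omega
        | hlift j y =>
          simp only [nodeMap_liftDart] at hxy
          obtain ⟨m, hm, hm'⟩ := hganc i x
          obtain ⟨m', hn, hn'⟩ := hganc j y
          rw [hxy, hn', hLev2, hLev2] at hm'
          obtain rfl : m' = m := by omega
          rw [hxy, hn] at hm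
          have := hinj _ _ (by omega) (by omega) hm
          obtain rfl : i = j := by ext; omega
          rw [(hg i).injective hxy]
    · intro x
      induction x using dart_cases with
      | hroot => exact ⟨0, rfl, rfl⟩
      | htop => exact ⟨1, hanc1, hLev1⟩
      | hlift i x =>
        obtain ⟨m, hm, hm'⟩ := hganc i x
        refine ⟨m + 2, ?_, ?_⟩
        · rw [nodeMap_liftDart, Function.iterate_succ_apply', Function.iterate_succ_apply', hm,
            hanc2, hanc1]
        · rw [nodeMap_liftDart, hm', hLev2]; omega

/-- A connected plane map with one more vertex than edges, rooted at a leaf, is a plane tree. -/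
theorem exists_dartEquiv {D W : Type*} [Fintype D] [Fintype W] {rot opp : D → D} {vtx : D → W}
    {r : D} (h : IsConnectedMap rot opp vtx r) (hr : rot r = r)
    (hcard : 2 * Fintype.card W = Fintype.card D + 2) :
    ∃ (T : PlantedTree) (g : T.Dart ≃ D), (∀ x, g (T.rot x) = rot (g x)) ∧
      (∀ x, g (PlantedTree.opp x) = opp (g x)) ∧ g T.rootDart = r := by
  obtain ⟨up, lev, hl⟩ := h.exists_isLeveling hcard
  have hr' : ¬ up r := fun hu => by
    have := hl.lev_eq _ hu
    rw [hl.lev_root] at this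
    omega
  obtain ⟨T, g, hg, hgr⟩ := exists_isLocal h hl hr'
  have hrot : ∀ x, g (T.rot x) = rot (g x) := by
    intro x
    by_cases hx : x = T.rootDart
    · rw [hx, rot_rootDart, hgr, hr]
    · rw [hg.rot_map x hx]
  -- The image contains the root and is closed under both maps, so connectedness makes it
  -- everything.
  have hsurj : Function.Surjective g := by
    refine h.connected (Set.range g) ⟨_, hgr⟩ ?_ ?_
    · rintro _ ⟨x, rfl⟩
      exact ⟨_, hrot x⟩
    · rintro _ ⟨x, rfl⟩
      exact ⟨_, (hg.opp_map x).symm⟩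
  exact ⟨T, Equiv.ofBijective g ⟨hg.injective, hsurj⟩, hrot, fun x => (hg.opp_map x).symm, hgr⟩

end PlantedTree

namespace PlantedTree

open PlaneMap

/-! ### Counting vertices -/

/-- The half-edges of `node c f`: the two halves of the root edge and those of the subtrees. -/
def dartEquiv (c : ℕ) (f : Fin c → PlantedTree) :
    (node c f).Dart ≃ Option (Option (Σ i, (f i).Dart)) where
  toFun := nodeMap none (some none) fun i x => some (some ⟨i, x⟩)
  invFun
    | none => (node c f).rootDart
    | some none => .up (node c f).top
    | some (some ⟨i, x⟩) => liftDart i x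
  left_inv x := by induction x using dart_cases <;> simp
  right_inv x := by rcases x with _ | _ | ⟨i, x⟩ <;> simp

instance finite_dart (T : PlantedTree) : Finite T.Dart := by
  induction T with
  | node c f ih => exact Finite.of_equiv _ (dartEquiv c f).symm

noncomputable instance fintypeDart (T : PlantedTree) : Fintype T.Dart := Fintype.ofFinite _

theorem sum_dart {c : ℕ} {f : Fin c → PlantedTree} (F : (node c f).Dart → ℕ) :
    ∑ x, F x = F (node c f).rootDart + (F (.up (node c f).top) + ∑ i, ∑ x, F (liftDart i x)) := by
  rw [← (dartEquiv c f).symm.sum_comp, Fintype.sum_option, Fintype.sum_option, Fintype.sum_sigma]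
  rfl

-- A vertex of degree k carries k half-edges, all of period k. The root half-edge is left out
-- because `g` need not respect the rotation there; for a subtree, that half-edge sits at the top
-- vertex of the whole tree and has period c + 1.
open Classical in
theorem IsLocal.sum_minimalPeriod {D : Type*} {rot opp : D → D} {T : PlantedTree}
    {g : T.Dart → D} (hg : IsLocal rot opp g) (k : ℕ) :
    (∑ x, if x ≠ T.rootDart ∧ Function.minimalPeriod rot (g x) = k then 1 else 0) =
      k * T.vertexCount k := by
  induction T with
  | node c f ih =>
    have hper : g (.up (node c f).top) ∈ Function.periodicPts rot := by
      rw [← Function.minimalPeriod_pos_iff_mem_periodicPts, hg.minimalPeriod_up_top]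
      omega
    have hroot : ∀ i : Fin c,
        Function.minimalPeriod rot (g (liftDart i (f i).rootDart)) = c + 1 := by
      intro i
      rw [← topDart_of_lt, ← hg.iterate_rot_up_top i.2.le,
        Function.minimalPeriod_apply_iterate hper, hg.minimalPeriod_up_top]
    have hsub : ∀ i : Fin c, (∑ x, if liftDart i x ≠ (node c f).rootDart ∧
        Function.minimalPeriod rot (g (liftDart i x)) = k then 1 else 0) =
        (if c + 1 = k then 1 else 0) + k * (f i).vertexCount k := by
      intro i
      have hδ : (∑ x, if x = (f i).rootDart then if c + 1 = k then 1 else 0 else 0) =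
        if c + 1 = k then 1 else 0 := by simp
      rw [← ih i (hg.lift i), ← hδ, ← Finset.sum_add_distrib]
      refine Finset.sum_congr rfl fun x _ => ?_
      by_cases hx : x = (f i).rootDart
      · simp [hx, hroot, liftDart_ne_rootDart]
      · simp [hx, liftDart_ne_rootDart]
    rw [sum_dart, Finset.sum_congr rfl fun i _ => hsub i, Finset.sum_add_distrib,
      hg.minimalPeriod_up_top, ← Finset.mul_sum, vertexCount]
    by_cases hk : c + 1 = k
    · have : Dart.up (node c f).top ≠ (node c f).rootDart := by simp [rootDart]
      simp [hk, this]
      rw [mul_add]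
      omega
    · simp [hk]

open Classical in
/-- The vertices of degree `k`, counted with multiplicity `k`. -/
theorem card_minimalPeriod (T : PlantedTree) (k : ℕ) :
    Fintype.card {x : T.Dart // Function.minimalPeriod T.rot x = k} =
      k * T.vertexCount k + if k = 1 then 1 else 0 := by
  have h1 : Function.minimalPeriod T.rot T.rootDart = 1 :=
    Function.minimalPeriod_eq_one_iff_isFixedPt.2 T.rot_rootDart
  have h := (isLocal_id T).sum_minimalPeriod k
  have hδ : (∑ x, if x = T.rootDart then if k = 1 then 1 else 0 else 0) =
    if k = 1 then 1 else 0 := by simp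
  rw [← h, Fintype.card_subtype, Finset.card_filter, ← hδ, ← Finset.sum_add_distrib]
  refine Finset.sum_congr rfl fun x _ => ?_
  by_cases hx : x = T.rootDart
  · simp [hx, h1, eq_comm]
  · simp [hx]

theorem vertexCount_node (d c : ℕ) (f : Fin c → PlantedTree) :
    (node c f).vertexCount d = (if c + 1 = d then 1 else 0) + ∑ i, (f i).vertexCount d := by
  rw [vertexCount]

theorem vertexCount_ne_zero_of_child {d c : ℕ} {f : Fin c → PlantedTree} (i : Fin c)
    (h : (f i).vertexCount d ≠ 0) : (node c f).vertexCount d ≠ 0 := by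
  rw [vertexCount_node]
  have := Finset.single_le_sum (f := fun i => (f i).vertexCount d) (fun _ _ => Nat.zero_le _)
    (Finset.mem_univ i)
  omega

theorem vertexCount_node_self (c : ℕ) (f : Fin c → PlantedTree) :
    (node c f).vertexCount (c + 1) ≠ 0 := by
  rw [vertexCount_node, if_pos rfl]; omega

/-- Euler's formula for a tree. -/
theorem sum_range_vertexCount (T : PlantedTree) (N : ℕ)
    (hN : ∀ d, T.vertexCount d ≠ 0 → d < N) :
    ∑ d ∈ Finset.range N, (2 - d : ℤ) * T.vertexCount d = 1 := by
  induction T with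
  | node c f ih =>
    have h1 : ∀ i, ∑ d ∈ Finset.range N, (2 - d : ℤ) * (f i).vertexCount d = 1 := fun i =>
      ih i fun d hd => hN d (vertexCount_ne_zero_of_child i hd)
    have h2 : c + 1 < N := hN _ (vertexCount_node_self c f)
    simp only [vertexCount_node, Nat.cast_add, mul_add, Finset.sum_add_distrib, Nat.cast_sum,
      Finset.mul_sum]
    -- The top vertex contributes 2 - (c + 1) and each of the c subtrees contributes 1.
    rw [Finset.sum_comm, Finset.sum_congr rfl fun i _ => h1 i]
    simp [h2]
    ring

theorem exists_vertexCount_bound (T : PlantedTree) : ∃ N, ∀ d, T.vertexCount d ≠ 0 → d < N := by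
  induction T with
  | node c f ih =>
    choose N hN using ih
    refine ⟨c + 2 + ∑ i, N i, fun d hd => ?_⟩
    by_contra! h
    refine hd ?_
    rw [vertexCount_node, if_neg (by omega), zero_add]
    refine Finset.sum_eq_zero fun i _ => ?_
    by_contra h'
    have h1 := hN i d h'
    have h2 := Finset.single_le_sum (f := N) (fun _ _ => Nat.zero_le _) (Finset.mem_univ i)
    omega

theorem sum_range_two_mul (M : ℕ) (F : ℕ → ℤ) :
    ∑ d ∈ Finset.range (2 * M), F d = ∑ j ∈ Finset.range M, (F (2 * j) + F (2 * j + 1)) := by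
  induction M with
  | zero => simp
  | succ M ih => rw [Nat.mul_succ, Finset.sum_range_succ, Finset.sum_range_succ, ih,
      Finset.sum_range_succ, add_assoc]

end PlantedTree

/-! ### The rank of a type and the number of leaves -/

theorem typeRank_eq_sum_range (α : ℕ →₀ ℕ) {N : ℕ} (hN : ∀ j, α j ≠ 0 → j < N) :
    typeRank α = ∑ j ∈ Finset.range N, (j - 1) * α j := by
  refine Finsupp.sum_of_support_subset _ (fun j hj => ?_) _ (by simp)
  exact Finset.mem_range.2 (hN j (Finsupp.mem_support_iff.1 hj))

theorem exists_support_bound (α : ℕ →₀ ℕ) : ∃ N, ∀ j, α j ≠ 0 → j < N :=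
  ⟨α.support.sup id + 1, fun _ hj => Nat.lt_succ_of_le
    (Finset.le_sup (f := id) (Finsupp.mem_support_iff.2 hj))⟩

namespace PlantedTree

/-- In Euler's formula the 2n - 1 non-root leaves contribute 1 each and a vertex of degree 2j
contributes -2(j - 1), so 2n - 1 - 2⟨α⟩ = 1. Minimality is thus automatic for a factorization read
off from a tree. -/
theorem HasType.typeRank_add_one {n : ℕ} {α : ℕ →₀ ℕ} {T : PlantedTree} (h : T.HasType n α) :
    typeRank α + 1 = n := by
  obtain ⟨N₁, h₁⟩ := exists_support_bound α
  obtain ⟨N₂, h₂⟩ := T.exists_vertexCount_bound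
  have hodd : ∀ j, j ≠ 0 → T.vertexCount (2 * j + 1) = 0 := by
    intro j hj
    by_contra h'
    obtain h' | ⟨i, h2, h'⟩ := h.only _ h' <;> omega
  have hzero : T.vertexCount (2 * 0) = 0 := by
    by_contra h'
    obtain h' | ⟨i, h2, h'⟩ := h.only _ h' <;> omega
  have htwo : T.vertexCount (2 * 1) = 0 := by
    by_contra h'
    obtain h' | ⟨i, h2, h'⟩ := h.only _ h' <;> omega
  have h3 := T.sum_range_vertexCount (2 * (N₁ + N₂ + 1)) fun d hd => by have := h₂ d hd; omega
  rw [sum_range_two_mul] at h3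
  have h4 : ∀ j ∈ Finset.range (N₁ + N₂ + 1),
      ((2 - (2 * j : ℕ) : ℤ) * T.vertexCount (2 * j) +
        (2 - (2 * j + 1 : ℕ) : ℤ) * T.vertexCount (2 * j + 1)) =
      (-2) * (((j - 1) * α j : ℕ) : ℤ) + if j = 0 then (T.vertexCount 1 : ℤ) else 0 := by
    intro j _
    rcases j with _ | _ | j
    · simpa using hzero
    · simpa [htwo] using hodd 1 one_ne_zero
    · rw [hodd _ (by omega), h.internal _ (by omega)]
      push_cast
      simp
      ring_nf
  rw [Finset.sum_congr rfl h4, Finset.sum_add_distrib, ← Finset.mul_sum, ← Nat.cast_sum,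
    ← typeRank_eq_sum_range α fun j hj => by have := h₁ j hj; omega] at h3
  have := h.leaves
  simp at h3
  omega

/-! ### Colouring the half-edges of a tree -/

/-- All vertices that are not leaves have even degree. -/
def IsEven (T : PlantedTree) : Prop := ∀ d, T.vertexCount d ≠ 0 → d = 1 ∨ Even d

/-- The half-edges are coloured as incoming (`true`) and outgoing (`false`) half-edges, and `ht` is
a height of the vertices that increases by one along each directed edge. -/
structure IsColoring (T : PlantedTree) (col : T.Dart → Bool) (ht : T.Dart → ℤ) : Prop where
  col_opp : ∀ x, col (opp x) = !col x
  ht_opp : ∀ x, ht (opp x) = ht x + if col x then -1 else 1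
  col_rot : ∀ x, T.rot x ≠ x → col (T.rot x) = !col x
  ht_rot : ∀ x, ht (T.rot x) = ht x

/-- A tree has no cycle that could obstruct the propagation of colours and heights from the root.
Arbitrary initial values are allowed so that the induction can pass to the subtrees with alternating
colours. -/
theorem exists_isColoring {T : PlantedTree} (hT : T.IsEven) (b : Bool) (z : ℤ) :
    ∃ col ht, IsColoring T col ht ∧ col T.rootDart = b ∧ ht T.rootDart = z := by
  induction T generalizing b z with
  | node c f ih =>
    have hsub : ∀ i, (f i).IsEven := fun i d hd => hT d (vertexCount_ne_zero_of_child i hd)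
    set z' : ℤ := z + if b then -1 else 1 with hz'
    choose col ht hch hcol hht using fun i : Fin c => ih i (hsub i) (b ^^ decide (Odd (i : ℕ))) z'
    have hc : c = 0 ∨ Odd c := by
      rcases hT _ (vertexCount_node_self c f) with h | h
      · left; omega
      · right; by_contra h'; rw [Nat.not_odd_iff_even] at h'; exact (Nat.even_add_one.1 h) h'
    -- At an internal vertex c is odd, so the alternation over the children closes up at the
    -- half-edge to the parent.
    have htop : c ≠ 0 → ∀ i ≤ c, nodeMap b (!b) col (topDart c f i) = (b ^^ decide (Odd i)) := by
      intro h0 i hi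
      rcases hi.lt_or_eq with hi | rfl
      · rw [topDart_of_lt ⟨i, hi⟩, nodeMap_liftDart, hcol]
      · rw [topDart_self, nodeMap_up_top]; simp [hc.resolve_left h0]
    have htop' : ∀ i, nodeMap z z' ht (topDart c f i) = z' := by
      intro i
      by_cases hi : i < c
      · rw [topDart_of_lt ⟨i, hi⟩, nodeMap_liftDart, hht]
      · rw [topDart, dif_neg hi, nodeMap_up_top]
    refine ⟨nodeMap b (!b) col, nodeMap z z' ht, ⟨?_, ?_, ?_, ?_⟩, rfl, rfl⟩
    · intro x
      induction x using dart_cases with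
      | hroot => rfl
      | htop => simp [opp_up_top]
      | hlift i x => simp [opp_liftDart, (hch i).col_opp]
    · intro x
      induction x using dart_cases with
      | hroot => rfl
      | htop => rw [opp_up_top]; cases b <;> simp [hz']
      | hlift i x => simp [opp_liftDart, (hch i).ht_opp]
    · intro x hx
      induction x using dart_cases with
      | hroot => exact absurd (rot_rootDart _) hx
      | htop =>
        have h0 : c ≠ 0 := by
          rintro rfl
          exact hx (by rw [rot_up_top, ← topDart_self])
        rw [rot_up_top, htop h0 0 (by omega)]
        simp
      | hlift i x =>
        by_cases h : x = (f i).rootDart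
        · have h0 : c ≠ 0 := by have := i.2; omega
          rw [h, rot_liftDart_rootDart, htop h0 _ i.2, nodeMap_liftDart, hcol]
          by_cases hi : Odd (i : ℕ) <;> simp [hi, Nat.odd_add_one]
        · rw [rot_liftDart i h] at hx ⊢
          rw [nodeMap_liftDart, nodeMap_liftDart, (hch i).col_rot]
          exact fun h' => hx (by rw [h'])
    · intro x
      induction x using dart_cases with
      | hroot => rw [rot_rootDart]
      | htop => rw [rot_up_top, htop', nodeMap_up_top]
      | hlift i x =>
        by_cases h : x = (f i).rootDart
        · rw [h, rot_liftDart_rootDart, htop', nodeMap_liftDart, hht]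
        · rw [rot_liftDart i h, nodeMap_liftDart, nodeMap_liftDart, (hch i).ht_rot]

end PlantedTree

open PlaneMap

namespace ProductDart

variable {n : ℕ} {l : List (Equiv.Perm (Fin n))}

/-! ### The plane map of a product -/

/-- Of two candidates for the next factor on a path, the earlier one would move k inside the gap
required by the later one. -/
theorem Arrow.right_unique {d a b : ProductDart l} (h : Arrow d a) (h' : Arrow d b) : a = b := by
  cases h with
  | tail_head k h =>
    cases h' with
    | tail_head => rfl
    | tail_inc j _ hj _ => exact absurd (h j) hj
  | tail_inc j k hj h =>
    cases h' with
    | tail_head _ h' => exact absurd (h' j) hj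
    | tail_inc j' _ hj' h' =>
      rcases lt_trichotomy j j' with hlt | rfl | hlt
      · exact absurd (h' j hlt) hj
      · rfl
      · exact absurd (h j' hlt) hj'
  | out_inc i j k hi hj hij h =>
    cases h' with
    | out_inc _ j' _ _ hj' hij' h' =>
      rcases lt_trichotomy j j' with hlt | rfl | hlt
      · exact absurd (h' j hij hlt) hj
      · rfl
      · exact absurd (h j' hij' hlt) hj'
    | out_head _ _ _ h' => exact absurd (h' j hij) hj
  | out_head i k hi h =>
    cases h' with
    | out_inc _ j' _ _ hj' hij' h' => exact absurd (h j' hij') hj'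
    | out_head => rfl

theorem Arrow.left_unique {d a b : ProductDart l} (h : Arrow a d) (h' : Arrow b d) : a = b := by
  cases h with
  | tail_head k h =>
    cases h' with
    | tail_head => rfl
    | out_head i _ hi _ => exact absurd (h i) hi
  | tail_inc j k hj h =>
    cases h' with
    | tail_inc => rfl
    | out_inc i _ _ hi _ hij _ => exact absurd (h i hij) hi
  | out_inc i j k hi hj hij h =>
    cases h' with
    | tail_inc _ _ _ h' => exact absurd (h' i hij) hi
    | out_inc i' _ _ hi' _ hij' h' =>
      rcases lt_trichotomy i i' with hlt | rfl | hlt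
      · exact absurd (h i' hlt hij') hi'
      · rfl
      · exact absurd (h' i hlt hij) hi
  | out_head i k hi h =>
    cases h' with
    | tail_head _ h' => exact absurd (h' i) hi
    | out_head i' _ hi' h' =>
      rcases lt_trichotomy i i' with hlt | rfl | hlt
      · exact absurd (h i' hlt) hi'
      · rfl
      · exact absurd (h' i hlt) hi

/-- Arrows start at tails or outgoing half-edges and end at heads or incoming ones. With the two
uniqueness lemmas, this makes the edges a perfect matching of the half-edges. -/
theorem Arrow.not_trans {a b d : ProductDart l} (h : Arrow a b) (h' : Arrow b d) : False := by
  cases h <;> cases h'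

theorem exists_first {m : ℕ} {p : Fin m → Prop} (h : ∃ j, p j) :
    ∃ j, p j ∧ ∀ r, r < j → ¬ p r := by
  obtain ⟨j, hj, hmin⟩ := wellFounded_lt.has_min {j | p j} h
  exact ⟨j, hj, fun r hr hp => hmin r hp hr⟩

theorem exists_last {m : ℕ} {p : Fin m → Prop} (h : ∃ j, p j) :
    ∃ j, p j ∧ ∀ r, j < r → ¬ p r := by
  obtain ⟨j, hj, hmin⟩ := wellFounded_gt.has_min {j | p j} h
  exact ⟨j, hj, fun r hr hp => hmin r hp hr⟩

theorem exists_arrow (d : ProductDart l) : ∃ d', Arrow d d' ∨ Arrow d' d := by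
  cases d with
  | tail k =>
    by_cases h : ∃ j, l.get j k ≠ k
    · obtain ⟨j, hj, hmin⟩ := exists_first h
      exact ⟨_, .inl (.tail_inc j k hj fun r hr => not_not.1 (hmin r hr))⟩
    · push Not at h
      exact ⟨_, .inl (.tail_head k h)⟩
  | head k =>
    by_cases h : ∃ j, l.get j k ≠ k
    · obtain ⟨j, hj, hmax⟩ := exists_last h
      exact ⟨_, .inr (.out_head j k hj fun r hr => not_not.1 (hmax r hr))⟩
    · push Not at h
      exact ⟨_, .inr (.tail_head k h)⟩
  | inc i k hk =>
    by_cases h : ∃ j, j < i ∧ l.get j k ≠ k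
    · obtain ⟨j, hj, hmax⟩ := exists_last h
      exact ⟨_, .inr (.out_inc j i k hj.2 hk hj.1 fun r hr hr' =>
        not_not.1 fun h' => hmax r hr ⟨hr', h'⟩)⟩
    · push Not at h
      exact ⟨_, .inr (.tail_inc i k hk h)⟩
  | out i k hk =>
    by_cases h : ∃ j, i < j ∧ l.get j k ≠ k
    · obtain ⟨j, hj, hmin⟩ := exists_first h
      exact ⟨_, .inl (.out_inc i j k hk hj.2 hj.1 fun r hr hr' =>
        not_not.1 fun h' => hmin r hr' ⟨hr, h'⟩)⟩
    · push Not at h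
      exact ⟨_, .inl (.out_head i k hk h)⟩

/-- The other half of the same edge. -/
noncomputable def opp (d : ProductDart l) : ProductDart l := (exists_arrow d).choose

theorem opp_spec (d : ProductDart l) : Arrow d d.opp ∨ Arrow d.opp d := (exists_arrow d).choose_spec

theorem opp_eq_iff {d d' : ProductDart l} : d.opp = d' ↔ Arrow d d' ∨ Arrow d' d := by
  refine ⟨fun h => h ▸ opp_spec d, fun h => ?_⟩
  rcases opp_spec d with h1 | h1 <;> rcases h with h2 | h2
  · exact h1.right_unique h2
  · exact (h2.not_trans h1).elim
  · exact (h1.not_trans h2).elim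
  · exact h1.left_unique h2

theorem Arrow.opp_eq {d d' : ProductDart l} (h : Arrow d d') : d.opp = d' := opp_eq_iff.2 (.inl h)

theorem Arrow.opp_eq' {d d' : ProductDart l} (h : Arrow d d') : d'.opp = d := opp_eq_iff.2 (.inr h)

theorem opp_opp (d : ProductDart l) : d.opp.opp = d := opp_eq_iff.2 (opp_spec d).symm

theorem rot_inc_ne (i : Fin l.length) (k : Fin n) (hk) :
    (inc i k hk : ProductDart l).rot ≠ inc i k hk :=
  nofun

theorem rot_out_ne (i : Fin l.length) (k : Fin n) (hk) :
    (out i k hk : ProductDart l).rot ≠ out i k hk :=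
  nofun

/-- The half-edge `d` carries the label `k` and is followed on its path only by factors of index at
least `p`. -/
def Before (d : ProductDart l) (p : ℕ) (k : Fin n) : Prop :=
  (d = tail k ∧ ∀ r : Fin l.length, (r : ℕ) < p → l.get r k = k) ∨
    ∃ i hi, d = out i k hi ∧ (i : ℕ) < p ∧
      ∀ r : Fin l.length, i < r → (r : ℕ) < p → l.get r k = k

theorem Before.opp_eq_head {d : ProductDart l} {k : Fin n} (h : d.Before l.length k) :
    d.opp = head k := by
  rcases h with ⟨rfl, h⟩ | ⟨i, hi, rfl, -, h⟩
  · exact (Arrow.tail_head k fun r => h r r.2).opp_eq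
  · exact (Arrow.out_head i k hi fun r hr => h r hr r.2).opp_eq

theorem Before.opp_eq_inc {d : ProductDart l} {k : Fin n} {p : Fin l.length} (h : d.Before p k)
    (hp : l.get p k ≠ k) : d.opp = inc p k hp := by
  rcases h with ⟨rfl, h⟩ | ⟨i, hi, rfl, hip, h⟩
  · exact (Arrow.tail_inc p k hp h).opp_eq
  · exact (Arrow.out_inc i p k hi hp hip h).opp_eq

theorem Before.succ {d : ProductDart l} {k : Fin n} {p : Fin l.length} (h : d.Before p k)
    (hp : l.get p k = k) : d.Before (p + 1) k := by
  have : ∀ r : Fin l.length, (r : ℕ) < p + 1 → (r : ℕ) < p ∨ r = p := by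
    intro r hr
    rcases Nat.lt_succ_iff_lt_or_eq.1 hr with h | h
    exacts [.inl h, .inr (Fin.ext h)]
  rcases h with ⟨rfl, h⟩ | ⟨i, hi, rfl, hip, h⟩
  · refine .inl ⟨rfl, fun r hr => ?_⟩
    rcases this r hr with h' | rfl
    exacts [h r h', hp]
  · refine .inr ⟨i, hi, rfl, by omega, fun r hr hr' => ?_⟩
    rcases this r hr' with h' | rfl
    exacts [h r hr h', hp]

theorem before_out (i : Fin l.length) (k : Fin n) (hk) :
    (out i k hk : ProductDart l).Before (i + 1) k :=
  .inr ⟨i, hk, rfl, by omega, fun r hr hr' => absurd hr (by rw [Fin.lt_def]; omega)⟩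

theorem before_tail (k : Fin n) : (tail k : ProductDart l).Before 0 k := .inl ⟨rfl, by simp⟩

/-- Entering a factor σ along k, the walk turns from incoming k to outgoing σ k. It therefore
applies the remaining factors in order. -/
theorem Before.nextLeaf {p : ℕ} (hp : p ≤ l.length) {d : ProductDart l} {k : Fin n}
    (h : d.Before p k) : NextLeaf rot opp d (head ((l.drop p).reverse.prod k)) := by
  induction hp using Nat.decreasingInduction generalizing d k with
  | @of_succ p hp ih =>
    rw [List.drop_eq_getElem_cons hp, List.reverse_cons, List.prod_append, List.prod_singleton,
      Equiv.Perm.mul_apply]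
    by_cases hk : l.get ⟨p, hp⟩ k = k
    · have := ih (h.succ (p := ⟨p, hp⟩) hk)
      rwa [← hk] at this
    · have h1 := h.opp_eq_inc (p := ⟨p, hp⟩) hk
      refine .go _ _ (by rw [h1]; exact rot_inc_ne _ _ _) ?_
      rw [h1]
      exact ih (before_out _ _ _)
  | self =>
    rw [List.drop_length]
    have h1 := h.opp_eq_head
    have := NextLeaf.arrive (rot := rot) (opp := opp) d (by rw [h1]; rfl)
    rwa [h1] at this

theorem nextLeaf_tail (k : Fin n) :
    NextLeaf rot opp (tail k : ProductDart l) (head (l.reverse.prod k)) :=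
  (before_tail k).nextLeaf (Nat.zero_le _)

/-- The half-edge `d` carries the label `k` and is preceded on its path only by factors of index
less than `p`. -/
def After (d : ProductDart l) (p : ℕ) (k : Fin n) : Prop :=
  (d = head k ∧ ∀ r : Fin l.length, p ≤ (r : ℕ) → l.get r k = k) ∨
    ∃ i hi, d = inc i k hi ∧ p ≤ (i : ℕ) ∧
      ∀ r : Fin l.length, p ≤ (r : ℕ) → r < i → l.get r k = k

theorem After.opp_eq_tail {d : ProductDart l} {k : Fin n} (h : d.After 0 k) : d.opp = tail k := by
  rcases h with ⟨rfl, h⟩ | ⟨i, hi, rfl, -, h⟩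
  · exact (Arrow.tail_head k fun r => h r (Nat.zero_le _)).opp_eq'
  · exact (Arrow.tail_inc i k hi fun r hr => h r (Nat.zero_le _) hr).opp_eq'

theorem After.opp_eq_out {d : ProductDart l} {k : Fin n} {p : Fin l.length}
    (h : d.After (p + 1) k) (hp : l.get p k ≠ k) : d.opp = out p k hp := by
  rcases h with ⟨rfl, h⟩ | ⟨i, hi, rfl, hip, h⟩
  · exact (Arrow.out_head p k hp h).opp_eq'
  · exact (Arrow.out_inc p i k hp hi hip h).opp_eq'

theorem After.pred {d : ProductDart l} {k : Fin n} {p : Fin l.length} (h : d.After (p + 1) k)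
    (hp : l.get p k = k) : d.After p k := by
  have : ∀ r : Fin l.length, (p : ℕ) ≤ r → (p : ℕ) + 1 ≤ r ∨ r = p := by
    intro r hr
    rcases hr.lt_or_eq with h | h
    exacts [.inl h, .inr (Fin.ext h.symm)]
  rcases h with ⟨rfl, h⟩ | ⟨i, hi, rfl, hip, h⟩
  · refine .inl ⟨rfl, fun r hr => ?_⟩
    rcases this r hr with h' | rfl
    exacts [h r h', hp]
  · refine .inr ⟨i, hi, rfl, by omega, fun r hr hr' => ?_⟩
    rcases this r hr with h' | rfl
    exacts [h r h' hr', hp]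

theorem after_inc (i : Fin l.length) (k : Fin n) (hk) : (inc i k hk : ProductDart l).After i k :=
  .inr ⟨i, hk, rfl, le_rfl, fun r hr hr' => absurd hr' (by rw [Fin.lt_def]; omega)⟩

theorem after_head (k : Fin n) : (head k : ProductDart l).After l.length k :=
  .inl ⟨rfl, fun r hr => absurd r.2 (by omega)⟩

/-- Against the direction of the edges the walk turns from outgoing k to incoming k, so the label
never changes and the walk follows the path k back to its start. -/
theorem After.nextLeaf {p : ℕ} (hp : p ≤ l.length) {d : ProductDart l} {k : Fin n}
    (h : d.After p k) : NextLeaf rot opp d (tail k) := by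
  induction p generalizing d with
  | zero =>
    have h1 := h.opp_eq_tail
    have := NextLeaf.arrive (rot := rot) (opp := opp) d (by rw [h1]; rfl)
    rwa [h1] at this
  | succ p ih =>
    by_cases hk : l.get ⟨p, hp⟩ k = k
    · exact ih (by omega) (h.pred (p := ⟨p, hp⟩) hk)
    · have h1 := h.opp_eq_out (p := ⟨p, hp⟩) hk
      refine .go _ _ (by rw [h1]; exact rot_out_ne _ _ _) ?_
      rw [h1]
      exact ih (by omega) (after_inc _ _ _)

theorem nextLeaf_head (k : Fin n) : NextLeaf rot opp (head k : ProductDart l) (tail k) :=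
  (after_head k).nextLeaf le_rfl

theorem nextLeaf_inc (i : Fin l.length) (k : Fin n) (hk) :
    NextLeaf rot opp (inc i k hk : ProductDart l) (tail k) :=
  (after_inc i k hk).nextLeaf i.2.le

/-! ### Vertices and half-edges -/

/-- The vertex of a half-edge: a leaf `t_k`, a leaf `h_k`, or the vertex of a factor. -/
def vtx : ProductDart l → (Fin n ⊕ Fin n) ⊕ Fin l.length
  | tail k => .inl (.inl k)
  | head k => .inl (.inr k)
  | inc i _ _ => .inr i
  | out i _ _ => .inr i

theorem vtx_rot (d : ProductDart l) : d.rot.vtx = d.vtx := by cases d <;> rfl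

theorem vtx_iterate_rot (m : ℕ) (d : ProductDart l) : (rot^[m] d).vtx = d.vtx := by
  induction m with
  | zero => rfl
  | succ m ih => rw [Function.iterate_succ_apply', vtx_rot, ih]

theorem get_pow_apply_ne {i : Fin l.length} {k : Fin n} (hk : l.get i k ≠ k) (m : ℕ) :
    l.get i ((l.get i ^ m) k) ≠ (l.get i ^ m) k := by
  rw [← Equiv.Perm.mul_apply, ← pow_succ', pow_succ, Equiv.Perm.mul_apply]
  exact fun h => hk ((l.get i ^ m).injective h)

theorem iterate_rot_inc (i : Fin l.length) (k : Fin n) (hk) (m : ℕ) :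
    rot^[2 * m] (inc i k hk : ProductDart l) = inc i ((l.get i ^ m) k) (get_pow_apply_ne hk m) := by
  induction m with
  | zero => rfl
  | succ m ih =>
    rw [Nat.mul_succ, Function.iterate_succ_apply', Function.iterate_succ_apply', ih]
    simp only [rot, inc.injEq, true_and]
    rw [pow_succ', Equiv.Perm.mul_apply]

theorem exists_iterate_rot_inc (hl : ∀ σ ∈ l, σ.IsCycle) (i : Fin l.length) (k : Fin n) (hk)
    (d : ProductDart l) (hd : d.vtx = .inr i) : ∃ m, rot^[m] (inc i k hk) = d := by
  cases d with
  | tail => cases hd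
  | head => cases hd
  | inc j k' hk' =>
    obtain rfl : j = i := by simpa [vtx] using hd
    obtain ⟨m, hm⟩ := (hl _ (l.get_mem j)).exists_pow_eq hk hk'
    exact ⟨2 * m, by rw [iterate_rot_inc]; simp [← hm]⟩
  | out j k' hk' =>
    obtain rfl : j = i := by simpa [vtx] using hd
    -- The outgoing half-edge labelled k' directly follows the incoming one labelled by the preimage
    -- of k'.
    have hk'' : l.get j ((l.get j).symm k') ≠ (l.get j).symm k' := by
      rw [Equiv.apply_symm_apply]
      exact fun h => hk' (by conv_lhs => rw [h, Equiv.apply_symm_apply])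
    obtain ⟨m, hm⟩ := (hl _ (l.get_mem j)).exists_pow_eq hk hk''
    refine ⟨2 * m + 1, ?_⟩
    rw [Function.iterate_succ_apply', iterate_rot_inc]
    simp only [rot, out.injEq, true_and]
    rw [hm, Equiv.apply_symm_apply]

theorem vtx_eq_iff (hl : ∀ σ ∈ l, σ.IsCycle) (d d' : ProductDart l) :
    d.vtx = d'.vtx ↔ ∃ m, rot^[m] d = d' := by
  refine ⟨fun h => ?_, fun ⟨m, hm⟩ => by rw [← hm, vtx_iterate_rot]⟩
  cases d with
  | tail k => cases d' <;> cases h; exact ⟨0, rfl⟩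
  | head k => cases d' <;> cases h; exact ⟨0, rfl⟩
  | inc i k hk => exact exists_iterate_rot_inc hl i k hk d' h.symm
  | out i k hk =>
    obtain ⟨m, hm⟩ := exists_iterate_rot_inc hl i k hk d' h.symm
    exact ⟨m + 1, hm⟩

theorem vtx_surjective (hl : ∀ σ ∈ l, σ.IsCycle) : Function.Surjective (vtx (l := l)) := by
  rintro ((k | k) | i)
  · exact ⟨tail k, rfl⟩
  · exact ⟨head k, rfl⟩
  · obtain ⟨k, hk, -⟩ := hl _ (l.get_mem i)
    exact ⟨inc i k hk, rfl⟩

/-- The half-edges: those at the leaves, and those at the vertices of the factors. -/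
def equivSum (l : List (Equiv.Perm (Fin n))) :
    ProductDart l ≃ (Fin n ⊕ Fin n) ⊕ Σ i : Fin l.length, {k // l.get i k ≠ k} × Bool where
  toFun
    | tail k => .inl (.inl k)
    | head k => .inl (.inr k)
    | inc i k hk => .inr ⟨i, ⟨k, hk⟩, true⟩
    | out i k hk => .inr ⟨i, ⟨k, hk⟩, false⟩
  invFun
    | .inl (.inl k) => tail k
    | .inl (.inr k) => head k
    | .inr ⟨i, k, true⟩ => inc i k.1 k.2
    | .inr ⟨i, k, false⟩ => out i k.1 k.2
  left_inv d := by cases d <;> rfl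
  right_inv d := by rcases d with (k | k) | ⟨i, k, _ | _⟩ <;> rfl

instance : Fintype (ProductDart l) := Fintype.ofEquiv _ (equivSum l).symm

theorem card_moved (σ : Equiv.Perm (Fin n)) : Fintype.card {k // σ k ≠ k} = σ.support.card :=
  Fintype.card_of_subtype _ fun _ => Equiv.Perm.mem_support

theorem sum_productDart (F : ProductDart l → ℕ) (v : (Fin n ⊕ Fin n) ⊕ Fin l.length → ℕ)
    (hF : ∀ d, F d = v d.vtx) :
    ∑ d, F d = ∑ k, (v (.inl (.inl k)) + v (.inl (.inr k))) +
      ∑ i, 2 * (l.get i).support.card * v (.inr i) := by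
  rw [← (equivSum l).symm.sum_comp, Fintype.sum_sum_type, Fintype.sum_sum_type, Fintype.sum_sigma,
    Finset.sum_add_distrib]
  congr 1
  · congr 1 <;> exact Finset.sum_congr rfl fun k _ => hF _
  · refine Finset.sum_congr rfl fun i _ => ?_
    rw [Finset.sum_congr rfl (g := fun _ => v (.inr i)), Finset.sum_const, Finset.card_univ,
      Fintype.card_prod, Fintype.card_bool, card_moved, smul_eq_mul, mul_comm _ 2]
    rintro ⟨k, _ | _⟩ - <;> exact hF _

theorem card_productDart :
    Fintype.card (ProductDart l) = 2 * n + ∑ i : Fin l.length, 2 * (l.get i).support.card := by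
  rw [Fintype.card_eq_sum_ones, sum_productDart _ (fun _ => 1) fun _ => rfl]
  simp [mul_comm]

/-- The degree of a vertex. -/
def deg (l : List (Equiv.Perm (Fin n))) : (Fin n ⊕ Fin n) ⊕ Fin l.length → ℕ
  | .inl _ => 1
  | .inr i => 2 * (l.get i).support.card

theorem card_vtx_eq (i : Fin l.length) :
    Nat.card {d : ProductDart l // d.vtx = .inr i} = 2 * (l.get i).support.card := by
  classical
  rw [Nat.card_eq_fintype_card, Fintype.card_subtype, Finset.card_filter,
    sum_productDart _ (fun w => if w = .inr i then 1 else 0) fun _ => rfl]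
  simp

end ProductDart

/-! ### Degrees and connectedness of the map of a product -/

theorem val_finRotate {n : ℕ} (k : Fin n) : (finRotate n k : ℕ) = (k + 1) % n := by
  cases n with
  | zero => exact k.elim0
  | succ n => simp [Fin.val_add]

theorem val_finRotate_pow {n : ℕ} (m : ℕ) (k : Fin n) :
    ((finRotate n ^ m) k : ℕ) = (k + m) % n := by
  induction m with
  | zero => simp [Nat.mod_eq_of_lt k.2]
  | succ m ih => rw [pow_succ', Equiv.Perm.mul_apply, val_finRotate, ih]; simp [add_assoc]

theorem Function.minimalPeriod_eq_ncard {D : Type*} {f : D → D} {x : D}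
    (hx : x ∈ Function.periodicPts f) :
    Function.minimalPeriod f x = {y | ∃ m, f^[m] x = y}.ncard := by
  have : {y | ∃ m, f^[m] x = y} = (fun m => f^[m] x) '' Set.Iio (Function.minimalPeriod f x) := by
    ext y
    constructor
    · rintro ⟨m, rfl⟩
      exact ⟨m % Function.minimalPeriod f x,
        Nat.mod_lt _ (Function.minimalPeriod_pos_of_mem_periodicPts hx),
        Function.iterate_mod_minimalPeriod_eq⟩
    · rintro ⟨m, -, rfl⟩
      exact ⟨m, rfl⟩
  rw [this, Function.iterate_injOn_Iio_minimalPeriod.ncard_image]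
  simp

namespace ProductDart

variable {n : ℕ} {l : List (Equiv.Perm (Fin n))}

theorem minimalPeriod_rot (hl : ∀ σ ∈ l, σ.IsCycle) (d : ProductDart l) :
    Function.minimalPeriod rot d = deg l d.vtx := by
  have hper : d ∈ Function.periodicPts rot := by
    obtain ⟨m, hm⟩ := (vtx_eq_iff hl d.rot d).1 (vtx_rot d)
    exact ⟨m + 1, by omega, hm⟩
  have key : ∀ i, d.vtx = .inr i → Function.minimalPeriod rot d = deg l d.vtx := by
    intro i hi
    rw [Function.minimalPeriod_eq_ncard hper, hi, deg, ← card_vtx_eq, ← Set.coe_ofPred,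
      Nat.card_coe_set_eq]
    congr 1
    ext d'
    rw [Set.mem_ofPred_eq, Set.mem_ofPred_eq, ← vtx_eq_iff hl, hi, eq_comm]
  cases d with
  | tail => exact Function.minimalPeriod_eq_one_iff_isFixedPt.2 rfl
  | head => exact Function.minimalPeriod_eq_one_iff_isFixedPt.2 rfl
  | inc i => exact key i rfl
  | out i => exact key i rfl

/-- Face walks join h_k to t_k and t_k to the next h-leaf; as the product is a single cycle, all
leaves are reached from h₀. Each incoming half-edge is joined to a t-leaf by its own walk. -/
theorem isConnectedMap [NeZero n] (hl : ∀ σ ∈ l, σ.IsCycle) (hprod : l.reverse.prod = finRotate n) :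
    IsConnectedMap rot opp (vtx (l := l)) (head 0) where
  opp_opp := opp_opp
  vtx_eq_iff := vtx_eq_iff hl
  vtx_surjective := vtx_surjective hl
  connected S h0 hrot hopp := by
    have hback : ∀ d, d.rot ∈ S → d ∈ S := by
      intro d hd
      obtain ⟨m, hm⟩ := (vtx_eq_iff hl d.rot d).1 (vtx_rot d)
      rw [← hm]
      clear hm
      induction m with
      | zero => exact hd
      | succ m ih => rw [Function.iterate_succ_apply']; exact hrot _ ih
    -- Membership in `S` is constant along a walk: by `hback`, `S` is also closed under turning
    -- back.
    have hwalk : ∀ d z : ProductDart l, NextLeaf rot opp d z → (d ∈ S ↔ z ∈ S) := by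
      intro d z h
      have hoppiff : ∀ d, opp d ∈ S ↔ d ∈ S := fun d =>
        ⟨fun h => by have := hopp _ h; rwa [opp_opp] at this, hopp d⟩
      induction h with
      | arrive e _ => rw [hoppiff]
      | go e z _ _ ih => exact (hoppiff e).symm.trans (Iff.trans ⟨hrot _, hback _⟩ ih)
    have hhead : ∀ k : Fin n, head k ∈ S := by
      have : ∀ m : ℕ, (head ((finRotate n ^ m) 0) : ProductDart l) ∈ S := by
        intro m
        induction m with
        | zero => exact h0
        | succ m ih =>
          rw [pow_succ', Equiv.Perm.mul_apply, ← hprod, ← hwalk _ _ (nextLeaf_tail _), hprod,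
            ← hwalk _ _ (nextLeaf_head _)]
          exact ih
      intro k
      have h1 := this k
      have h2 : (finRotate n ^ (k : ℕ)) 0 = k := by
        ext
        rw [val_finRotate_pow, Fin.val_zero, zero_add, Nat.mod_eq_of_lt k.2]
      rwa [h2] at h1
    have htail : ∀ k : Fin n, tail k ∈ S := fun k => (hwalk _ _ (nextLeaf_head k)).1 (hhead k)
    have hinc : ∀ i k hk, inc i k hk ∈ S := fun i k hk =>
      (hwalk _ _ (nextLeaf_inc i k hk)).2 (htail k)
    rintro (k | k | ⟨i, k, hk⟩ | ⟨i, k, hk⟩)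
    exacts [htail k, hhead k, hinc i k hk, hback _ (hinc i k hk)]

end ProductDart

namespace PlantedTree

theorem sum_ite_card_support {n : ℕ} (l : List (Equiv.Perm (Fin n))) (k : ℕ) :
    (∑ i : Fin l.length, 2 * (l.get i).support.card *
      if 2 * (l.get i).support.card = k then 1 else 0) =
    k * l.countP fun σ => 2 * σ.support.card = k := by
  refine (Fin.sum_univ_fun_getElem l fun σ => 2 * σ.support.card *
    if 2 * σ.support.card = k then 1 else 0).trans ?_
  induction l with
  | nil => simp
  | cons σ l ih =>
    rw [List.map_cons, List.sum_cons, ih, List.countP_cons]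
    by_cases h : 2 * σ.support.card = k
    · simp [h, mul_add, add_comm]
    · simp [h]

variable {n : ℕ} [NeZero n] {l l' : List (Equiv.Perm (Fin n))} {T T' : PlantedTree}

theorem isTreeOfProduct_iff : T.IsTreeOfProduct l ↔ ∃ φ : ProductDart l ≃ T.Dart,
    (∀ d, φ d.rot = T.rot (φ d)) ∧ (∀ d, φ d.opp = opp (φ d)) ∧ φ (.head 0) = T.rootDart := by
  refine exists_congr fun φ => and_congr_right fun _ => and_congr_left fun _ => ⟨?_, ?_⟩
  · exact fun h d => ((h d d.opp).1 d.opp_spec).symm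
  · exact fun h d d' => by rw [← h, φ.apply_eq_iff_eq, ProductDart.opp_eq_iff]

/-! ### The tree of a product is unique, and its vertices -/

theorem IsTreeOfProduct.unique (h : T.IsTreeOfProduct l) (h' : T'.IsTreeOfProduct l) : T = T' := by
  have key : ∀ {T : PlantedTree}, T.IsTreeOfProduct l → ∃ g : T.Dart → ProductDart l,
      IsLocal ProductDart.rot ProductDart.opp g ∧ g T.rootDart = .head 0 := by
    intro T h
    obtain ⟨φ, h1, h2, h3⟩ := isTreeOfProduct_iff.1 h
    refine ⟨φ.symm, ⟨fun x => ?_, fun x _ => ?_, φ.symm.injective⟩, by rw [← h3]; simp⟩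
    · rw [Equiv.eq_symm_apply, h2, Equiv.apply_symm_apply]
    · rw [Equiv.eq_symm_apply, h1, Equiv.apply_symm_apply]
  obtain ⟨g, hg, hr⟩ := key h
  obtain ⟨g', hg', hr'⟩ := key h'
  exact hg.tree_unique hg' (hr.trans hr'.symm)

theorem vertexCount_zero (T : PlantedTree) : T.vertexCount 0 = 0 := by
  induction T with
  | node c f ih => simp [vertexCount_node, ih]

/-- Both sides count the half-edges at vertices of degree k. The extra 1 for k = 1 is the root leaf,
which `vertexCount` omits. -/
theorem IsTreeOfProduct.mul_vertexCount (h : T.IsTreeOfProduct l) (hl : ∀ σ ∈ l, σ.IsCycle)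
    (k : ℕ) : (k * T.vertexCount k + if k = 1 then 1 else 0) =
      (if k = 1 then 2 * n else 0) + k * l.countP fun σ => 2 * σ.support.card = k := by
  classical
  obtain ⟨φ, h1, -, -⟩ := isTreeOfProduct_iff.1 h
  have hper : ∀ d,
      Function.minimalPeriod T.rot (φ d) = Function.minimalPeriod ProductDart.rot d := by
    intro d
    rw [Function.minimalPeriod_eq_minimalPeriod_iff]
    intro m
    have hsc : Function.Semiconj φ ProductDart.rot T.rot := h1
    rw [Function.IsPeriodicPt, Function.IsFixedPt, ← (hsc.iterate_right m).eq d,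
      φ.apply_eq_iff_eq]
    rfl
  rw [← card_minimalPeriod, ← sum_ite_card_support, Fintype.card_subtype, Finset.card_filter,
    ← φ.sum_comp, ProductDart.sum_productDart _ (fun w => if ProductDart.deg l w = k then 1 else 0)
      fun d => by rw [hper, ProductDart.minimalPeriod_rot hl]]
  congr 1
  by_cases hk : k = 1
  · simp [ProductDart.deg, hk, mul_comm]
  · simp [ProductDart.deg, hk, Ne.symm hk]

theorem IsTreeOfProduct.vertexCount_one (h : T.IsTreeOfProduct l) (hl : ∀ σ ∈ l, σ.IsCycle) :
    T.vertexCount 1 + 1 = 2 * n := by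
  have := h.mul_vertexCount hl 1
  have h0 : (l.countP fun σ => 2 * σ.support.card = 1) = 0 := by
    rw [List.countP_eq_zero]
    intro σ _
    simp only [decide_eq_true_eq]
    omega
  simpa [h0] using this

theorem IsTreeOfProduct.vertexCount_two_mul (h : T.IsTreeOfProduct l) (hl : ∀ σ ∈ l, σ.IsCycle)
    {j : ℕ} (hj : j ≠ 0) :
    T.vertexCount (2 * j) = l.countP fun σ => σ.support.card = j := by
  have h1 := h.mul_vertexCount hl (2 * j)
  rw [if_neg (by omega), if_neg (by omega), add_zero, zero_add] at h1
  rw [Nat.eq_of_mul_eq_mul_left (by omega) h1]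
  congr 1
  ext σ
  simp

theorem IsTreeOfProduct.hasType {α : ℕ →₀ ℕ} (h : T.IsTreeOfProduct l)
    (hl : IsMinimalFactorization n α l) : T.HasType n α where
  leaves := h.vertexCount_one hl.isCycle
  internal j hj := by rw [h.vertexCount_two_mul hl.isCycle (by omega), hl.type_eq j hj]
  only d hd := by
    by_cases hd1 : d = 1
    · exact .inl hd1
    · right
      have hd0 : d ≠ 0 := by rintro rfl; exact hd T.vertexCount_zero
      have h1 := h.mul_vertexCount hl.isCycle d
      rw [if_neg hd1, if_neg hd1, add_zero, zero_add] at h1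
      rw [Nat.eq_of_mul_eq_mul_left (by omega) h1, ← Nat.pos_iff_ne_zero, List.countP_pos_iff] at hd
      obtain ⟨σ, hσ, hσd⟩ := hd
      exact ⟨σ.support.card, (hl.isCycle σ hσ).two_le_card_support,
        (by simpa using hσd : 2 * σ.support.card = d).symm⟩

theorem IsTreeOfProduct.isMinimalFactorization {α : ℕ →₀ ℕ} (h : T.IsTreeOfProduct l)
    (hT : T.HasType n α) (hl : ∀ σ ∈ l, σ.IsCycle) (hprod : l.reverse.prod = finRotate n) :
    IsMinimalFactorization n α l where
  isCycle := hl
  prod_eq := hprod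
  type_eq j hj := by rw [← h.vertexCount_two_mul hl (by omega), hT.internal j hj]
  minimal := hT.typeRank_add_one

end PlantedTree

/-! ### The tree of a minimal factorization -/

theorem List.sum_map_eq_sum_range_countP {X : Type*} (l : List X) (c : X → ℕ) (F : ℕ → ℕ) {N : ℕ}
    (hN : ∀ x ∈ l, c x < N) :
    (l.map fun x => F (c x)).sum = ∑ j ∈ Finset.range N, F j * l.countP fun x => c x = j := by
  induction l with
  | nil => simp
  | cons x l ih =>
    rw [List.map_cons, List.sum_cons, ih fun y hy => hN y (List.mem_cons_of_mem _ hy)]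
    simp only [List.countP_cons, mul_add, Finset.sum_add_distrib, decide_eq_true_eq]
    simp [hN x List.mem_cons_self, add_comm]

namespace IsMinimalFactorization

variable {n : ℕ} {α : ℕ →₀ ℕ} {l : List (Equiv.Perm (Fin n))}

/-- The rank is the sum of the cycle lengths, each diminished by one. The truncated subtraction is
harmless because every factor moves at least two points. -/
theorem sum_card_support (h : IsMinimalFactorization n α l) :
    ∑ i : Fin l.length, (l.get i).support.card + 1 = n + l.length := by
  obtain ⟨N, hN⟩ := exists_support_bound α
  have h1 : (l.map fun σ => σ.support.card - 1).sum = typeRank α := by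
    rw [List.sum_map_eq_sum_range_countP l (fun σ => σ.support.card) (fun j => j - 1)
      (N := N + n + 1), typeRank_eq_sum_range α (N := N + n + 1)]
    · refine Finset.sum_congr rfl fun j _ => ?_
      by_cases hj : 2 ≤ j
      · rw [h.type_eq j hj]
      · rw [show j - 1 = 0 by omega, zero_mul, zero_mul]
    · intro j hj
      have := hN j hj
      omega
    · intro σ _
      have := σ.support.card_le_univ
      rw [Fintype.card_fin] at this
      omega
  have h2 : (l.map fun σ => σ.support.card).sum =
      (l.map fun σ => σ.support.card - 1).sum + l.length := by
    have hl := h.isCycle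
    clear h1 h
    induction l with
    | nil => rfl
    | cons σ l ih =>
      have h3 := (hl σ List.mem_cons_self).two_le_card_support
      simp only [List.map_cons, List.sum_cons, List.length_cons,
        ih fun τ hτ => hl τ (List.mem_cons_of_mem _ hτ)]
      omega
  have h3 := Fin.sum_univ_fun_getElem l fun σ => σ.support.card
  have h4 := h.minimal
  simp only [List.get_eq_getElem]
  rw [h3, h2, h1]
  omega

/-- With m factors there are 2n + m vertices, and each path k has one edge more than there are
factors moving k. The identity is the tree condition that vertices outnumber edges by one. -/
theorem card_vertices (h : IsMinimalFactorization n α l) :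
    2 * Fintype.card ((Fin n ⊕ Fin n) ⊕ Fin l.length) = Fintype.card (ProductDart l) + 2 := by
  have := h.sum_card_support
  rw [ProductDart.card_productDart, ← Finset.mul_sum, Fintype.card_sum, Fintype.card_sum,
    Fintype.card_fin, Fintype.card_fin]
  omega

theorem exists_isTreeOfProduct [NeZero n] (h : IsMinimalFactorization n α l) :
    ∃ T : PlantedTree, T.IsTreeOfProduct l := by
  obtain ⟨T, g, h1, h2, h3⟩ := PlantedTree.exists_dartEquiv
    (ProductDart.isConnectedMap h.isCycle h.prod_eq) rfl h.card_vertices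
  refine ⟨T, PlantedTree.isTreeOfProduct_iff.2 ⟨g.symm, fun d => ?_, fun d => ?_, ?_⟩⟩
  · rw [Equiv.symm_apply_eq, h1, Equiv.apply_symm_apply]
  · rw [Equiv.symm_apply_eq, h2, Equiv.apply_symm_apply]
  · rw [Equiv.symm_apply_eq, h3]

/-- Neighbouring factors that commute are disjoint. -/
theorem disjoint_of_commute [NeZero n] (h : IsMinimalFactorization n α l) {i j : Fin l.length}
    (hij : (j : ℕ) = i + 1) (hc : Commute (l.get i) (l.get j)) {k : Fin n}
    (hi : l.get i k ≠ k) (hj : l.get j k ≠ k) : False := by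
  obtain ⟨up, lev, hl⟩ :=
    (ProductDart.isConnectedMap h.isCycle h.prod_eq).exists_isLeveling h.card_vertices
  have harrow : ∀ (k : Fin n) (hi : l.get i k ≠ k) (hj : l.get j k ≠ k),
      (ProductDart.out i k hi).opp = ProductDart.inc j k hj := fun k hi hj =>
    (ProductDart.Arrow.out_inc i j k hi hj (by rw [Fin.lt_def]; omega) fun r hr hr' => by
      rw [Fin.lt_def] at hr hr'; omega).opp_eq
  have hi' : l.get i (l.get i k) ≠ l.get i k := fun h => hi ((l.get i).injective h)
  -- Commutation makes the image of k a second common moved point, so the two vertices are joined by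
  -- two different edges.
  have hj' : l.get j (l.get i k) ≠ l.get i k := by
    rw [← Equiv.Perm.mul_apply, ← hc.eq, Equiv.Perm.mul_apply]
    exact fun h => hj ((l.get i).injective h)
  have := hl.no_double_edge ProductDart.opp_opp
    (d := .out i k hi) (d' := .out i (l.get i k) hi') rfl
    (by rw [harrow _ _ hj, harrow _ _ hj']; rfl)
  exact hi (ProductDart.out.inj this).2.symm

end IsMinimalFactorization

/-! ### Reordering the factors -/

namespace ProductDart

variable {n : ℕ} {l l' : List (Equiv.Perm (Fin n))}

/-- The map of half-edges induced by a bijection between the factors of two products. -/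
def reorder (e : Fin l'.length ≃ Fin l.length) (he : ∀ i, l'.get i = l.get (e i)) :
    ProductDart l ≃ ProductDart l' where
  toFun
    | tail k => tail k
    | head k => head k
    | inc i k hk => inc (e.symm i) k (by rwa [he, e.apply_symm_apply])
    | out i k hk => out (e.symm i) k (by rwa [he, e.apply_symm_apply])
  invFun
    | tail k => tail k
    | head k => head k
    | inc i k hk => inc (e i) k (by rwa [← he])
    | out i k hk => out (e i) k (by rwa [← he])
  left_inv d := by cases d <;> simp
  right_inv d := by cases d <;> simp

theorem reorder_rot (e : Fin l'.length ≃ Fin l.length) (he : ∀ i, l'.get i = l.get (e i))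
    (d : ProductDart l) : reorder e he d.rot = (reorder e he d).rot := by
  cases d with
  | inc i k hk =>
    simp only [reorder, rot, Equiv.coe_fn_mk, out.injEq, true_and]
    rw [he, e.apply_symm_apply]
  | _ => rfl

/-- The path k depends only on the relative order of the factors that move k. -/
theorem Arrow.reorder {e : Fin l'.length ≃ Fin l.length} {he : ∀ i, l'.get i = l.get (e i)}
    (hmono : ∀ i j, i < j → ∀ k, l'.get i k ≠ k → l'.get j k ≠ k → e i < e j)
    {d d' : ProductDart l} (h : Arrow d d') :
    Arrow (ProductDart.reorder e he d) (ProductDart.reorder e he d') := by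
  have hfix : ∀ {k : Fin n} {r : Fin l'.length}, l.get (e r) k = k → l'.get r k = k := by
    intro k r h; rwa [he]
  have hlt : ∀ {i j : Fin l'.length} {k : Fin n}, l'.get i k ≠ k → l'.get j k ≠ k →
      i < j → e i < e j := fun hi hj hij => hmono _ _ hij _ hi hj
  have hlt' : ∀ {i j : Fin l'.length} {k : Fin n}, l'.get i k ≠ k → l'.get j k ≠ k →
      e i < e j → i < j := by
    intro i j k hi hj hij
    rcases lt_trichotomy i j with h | rfl | h
    · exact h
    · exact absurd hij (lt_irrefl _)
    · exact absurd hij (hlt hj hi h).not_gt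
  have hsymm : ∀ {i : Fin l.length} {k : Fin n}, l.get i k ≠ k → l'.get (e.symm i) k ≠ k := by
    intro i k h; rwa [he, e.apply_symm_apply]
  cases h with
  | tail_head k h => exact .tail_head k fun r => hfix (h _)
  | tail_inc j k hj h =>
    refine .tail_inc _ k _ fun r hr => by_contra fun h' => h' (hfix (h _ ?_))
    have := hlt h' (hsymm hj) hr
    rwa [e.apply_symm_apply] at this
  | out_inc i j k hi hj hij h =>
    refine .out_inc _ _ k _ _ (hlt' (hsymm hi) (hsymm hj) (by simpa using hij)) fun r hr hr' =>
      by_contra fun h' => h' (hfix (h _ ?_ ?_))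
    · have := hlt (hsymm hi) h' hr
      rwa [e.apply_symm_apply] at this
    · have := hlt h' (hsymm hj) hr'
      rwa [e.apply_symm_apply] at this
  | out_head i k hi h =>
    refine .out_head _ k _ fun r hr => by_contra fun h' => h' (hfix (h _ ?_))
    have := hlt (hsymm hi) h' hr
    rwa [e.apply_symm_apply] at this

end ProductDart

theorem PlantedTree.IsTreeOfProduct.reorder {n : ℕ} [NeZero n] {l l' : List (Equiv.Perm (Fin n))}
    {T : PlantedTree} (h : T.IsTreeOfProduct l) (e : Fin l'.length ≃ Fin l.length)
    (he : ∀ i, l'.get i = l.get (e i))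
    (hmono : ∀ i j, i < j → ∀ k, l'.get i k ≠ k → l'.get j k ≠ k → e i < e j) :
    T.IsTreeOfProduct l' := by
  obtain ⟨φ, h1, h2, h3⟩ := PlantedTree.isTreeOfProduct_iff.1 h
  have hopp : ∀ d : ProductDart l,
      ProductDart.reorder e he d.opp = (ProductDart.reorder e he d).opp := by
    intro d
    refine (ProductDart.opp_eq_iff.2 ?_).symm
    exact d.opp_spec.imp (·.reorder hmono) (·.reorder hmono)
  refine PlantedTree.isTreeOfProduct_iff.2
    ⟨(ProductDart.reorder e he).symm.trans φ, fun d => ?_, fun d => ?_, h3⟩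
  · obtain ⟨d, rfl⟩ := (ProductDart.reorder e he).surjective d
    rw [← ProductDart.reorder_rot]
    simp [h1]
  · obtain ⟨d, rfl⟩ := (ProductDart.reorder e he).surjective d
    rw [← hopp]
    simp [h2]

/-! ### Commutation moves preserve the tree -/

namespace CommutationMove

variable {n : ℕ} {α : ℕ →₀ ℕ} {l l' : List (Equiv.Perm (Fin n))}

theorem symm (h : CommutationMove l l') : CommutationMove l' l := by
  obtain ⟨a, b, σ, τ, hc, hl, hl'⟩ := h
  exact ⟨a, b, τ, σ, hc.symm, hl', hl⟩

theorem prod_eq (h : CommutationMove l l') : l.reverse.prod = l'.reverse.prod := by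
  obtain ⟨a, b, σ, τ, hc, rfl, rfl⟩ := h
  simp only [List.reverse_append, List.reverse_cons, List.prod_append, List.prod_singleton]
  rw [mul_assoc b.reverse.prod, hc.symm.eq, ← mul_assoc b.reverse.prod]

theorem perm (h : CommutationMove l l') : l.Perm l' := by
  obtain ⟨a, b, σ, τ, hc, rfl, rfl⟩ := h
  exact (List.Perm.swap _ _ _).append_left a

theorem isMinimalFactorization (h : CommutationMove l l') (hl : IsMinimalFactorization n α l) :
    IsMinimalFactorization n α l' where
  isCycle σ hσ := hl.isCycle σ (h.perm.mem_iff.2 hσ)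
  prod_eq := by rw [← h.prod_eq, hl.prod_eq]
  type_eq j hj := by rw [← h.perm.countP_eq, hl.type_eq j hj]
  minimal := hl.minimal

theorem isTreeOfProduct [NeZero n] {T : PlantedTree} (h : CommutationMove l l')
    (hl : IsMinimalFactorization n α l) (hT : T.IsTreeOfProduct l) : T.IsTreeOfProduct l' := by
  have hl' := h.isMinimalFactorization hl
  have hlen := h.perm.length_eq
  obtain ⟨a, b, σ, τ, hc, hσ, hτ⟩ := h
  have hlen' : l'.length = a.length + (b.length + 2) := by simp [hτ]
  let p : Fin l.length := ⟨a.length, by omega⟩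
  let q : Fin l.length := ⟨a.length + 1, by omega⟩
  let e : Fin l'.length ≃ Fin l.length := (finCongr hlen.symm).trans (Equiv.swap p q)
  have hp : ∀ i : Fin l'.length, (i : ℕ) = a.length → e i = q := by
    intro i hi
    have : finCongr hlen.symm i = p := Fin.ext hi
    simp only [e, Equiv.trans_apply, this, Equiv.swap_apply_left]
  have hq : ∀ i : Fin l'.length, (i : ℕ) = a.length + 1 → e i = p := by
    intro i hi
    have : finCongr hlen.symm i = q := Fin.ext hi
    simp only [e, Equiv.trans_apply, this, Equiv.swap_apply_right]
  have ho : ∀ i : Fin l'.length, (i : ℕ) ≠ a.length → (i : ℕ) ≠ a.length + 1 →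
      (e i : ℕ) = i := by
    intro i h1 h2
    have h3 : finCongr hlen.symm i ≠ p := fun h => h1 (congrArg Fin.val h)
    have h4 : finCongr hlen.symm i ≠ q := fun h => h2 (congrArg Fin.val h)
    simp only [e, Equiv.trans_apply, Equiv.swap_apply_of_ne_of_ne h3 h4]
    rfl
  have hgp : ∀ i : Fin l'.length, (i : ℕ) = a.length → l'.get i = τ := by
    intro i hi
    simp [hτ, hi]
  have hgq : ∀ i : Fin l'.length, (i : ℕ) = a.length + 1 → l'.get i = σ := by
    intro i hi
    simp [hτ, hi]
  refine hT.reorder e (fun i => ?_) fun i j hij k hi hj => ?_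
  · by_cases h1 : (i : ℕ) = a.length
    · rw [hp i h1, hgp i h1]; simp [hσ, q]
    by_cases h2 : (i : ℕ) = a.length + 1
    · rw [hq i h2, hgq i h2]; simp [hσ, p]
    · simp only [List.get_eq_getElem, ho i h1 h2]
      apply Option.some_injective
      rw [← List.getElem?_eq_getElem, ← List.getElem?_eq_getElem]
      generalize (i : ℕ) = m at h1 h2 ⊢
      rw [hσ, hτ]
      rcases lt_or_ge m a.length with h3 | h3
      · rw [List.getElem?_append_left h3, List.getElem?_append_left h3]
      · rw [List.getElem?_append_right h3, List.getElem?_append_right h3]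
        obtain ⟨r, hr⟩ : ∃ r, m - a.length = r + 2 := ⟨m - a.length - 2, by omega⟩
        rw [hr]; rfl
  · rw [Fin.lt_def] at hij ⊢
    by_cases h1 : (i : ℕ) = a.length ∧ (j : ℕ) = a.length + 1
    -- The interchanged pair is the only one whose order is reversed, and it has no common label.
    · refine (hl'.disjoint_of_commute (i := i) (j := j) (by omega) ?_ hi hj).elim
      rw [hgp i h1.1, hgq j h1.2]
      exact hc.symm
    · have hpv : (p : ℕ) = a.length := rfl
      have hqv : (q : ℕ) = a.length + 1 := rfl
      by_cases h2 : (i : ℕ) = a.length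
      · rw [hp i h2, ho j (by omega) (by omega)]; omega
      by_cases h3 : (i : ℕ) = a.length + 1
      · rw [hq i h3, ho j (by omega) (by omega)]; omega
      by_cases h4 : (j : ℕ) = a.length
      · rw [hp j h4, ho i h2 h3]; omega
      by_cases h5 : (j : ℕ) = a.length + 1
      · rw [hq j h5, ho i h2 h3]; omega
      rw [ho i h2 h3, ho j h4 h5]; omega

end CommutationMove

/-- Equivalent factorizations have the same tree. -/
theorem Relation.EqvGen.commutationMove {n : ℕ} [NeZero n] {α : ℕ →₀ ℕ}
    {l l' : List (Equiv.Perm (Fin n))} (h : Relation.EqvGen CommutationMove l l') :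
    (IsMinimalFactorization n α l ↔ IsMinimalFactorization n α l') ∧
      (IsMinimalFactorization n α l →
        ∀ T : PlantedTree, T.IsTreeOfProduct l ↔ T.IsTreeOfProduct l') := by
  induction h with
  | rel l l' h =>
    exact ⟨⟨h.isMinimalFactorization, h.symm.isMinimalFactorization⟩, fun hl T =>
      ⟨h.isTreeOfProduct hl, h.symm.isTreeOfProduct (h.isMinimalFactorization hl)⟩⟩
  | refl => exact ⟨Iff.rfl, fun _ _ => Iff.rfl⟩
  | symm l l' _ ih => exact ⟨ih.1.symm, fun hl T => (ih.2 (ih.1.2 hl) T).symm⟩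
  | trans l l' l'' _ _ ih ih' =>
    exact ⟨ih.1.trans ih'.1, fun hl T => (ih.2 hl T).trans (ih'.2 (ih.1.1 hl) T)⟩

namespace PlantedTree

/-! ### Rotation and leaves of a tree -/

theorem IsLocal.mem_periodicPts {D : Type*} {rot opp : D → D} {T : PlantedTree} {g : T.Dart → D}
    (hg : IsLocal rot opp g) {x : T.Dart} (hx : x ≠ T.rootDart) :
    g x ∈ Function.periodicPts rot := by
  induction T with
  | node c f ih =>
    have htop : g (.up (node c f).top) ∈ Function.periodicPts rot := by
      rw [← Function.minimalPeriod_pos_iff_mem_periodicPts, hg.minimalPeriod_up_top]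
      omega
    induction x using dart_cases with
    | hroot => exact absurd rfl hx
    | htop => exact htop
    | hlift i x =>
      by_cases h : x = (f i).rootDart
      · rw [h, ← topDart_of_lt, ← hg.iterate_rot_up_top i.2.le]
        exact (Function.bijOn_periodicPts rot).mapsTo.iterate _ htop
      · exact ih i (hg.lift i) h

theorem mem_periodicPts {T : PlantedTree} (x : T.Dart) : x ∈ Function.periodicPts T.rot := by
  by_cases hx : x = T.rootDart
  · exact ⟨1, one_pos, hx ▸ T.rot_rootDart⟩
  · exact (isLocal_id T).mem_periodicPts hx

theorem rot_injective (T : PlantedTree) : Function.Injective T.rot := fun x y h =>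
  (Function.bijOn_periodicPts T.rot).injOn (mem_periodicPts x) (mem_periodicPts y) h

theorem opp_injective {T : PlantedTree} : Function.Injective (opp (T := T)) :=
  Function.LeftInverse.injective opp_opp

/-- The rotation as a permutation. -/
noncomputable def rotPerm (T : PlantedTree) : Equiv.Perm T.Dart :=
  Equiv.ofBijective T.rot (Finite.injective_iff_bijective.1 T.rot_injective)

theorem rot_rotPerm_symm {T : PlantedTree} (x : T.Dart) : T.rot (T.rotPerm.symm x) = x :=
  T.rotPerm.apply_symm_apply x

theorem mem_star_self {T : PlantedTree} (x : T.Dart) : x ∈ star x := ⟨0, rfl⟩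

theorem rot_mem_star {T : PlantedTree} {x y : T.Dart} (h : y ∈ star x) : T.rot y ∈ star x := by
  obtain ⟨r, rfl⟩ := h
  exact ⟨r + 1, Function.iterate_succ_apply' _ _ _⟩

theorem mem_star_symm {T : PlantedTree} {x y : T.Dart} (h : y ∈ star x) : x ∈ star y := by
  obtain ⟨r, rfl⟩ := h
  have hpos := Function.minimalPeriod_pos_of_mem_periodicPts (mem_periodicPts x)
  -- The orbit is completed to r full turns.
  obtain ⟨s, hs⟩ : ∃ s, s + r = Function.minimalPeriod T.rot x * r :=
    ⟨Function.minimalPeriod T.rot x * r - r, Nat.sub_add_cancel (Nat.le_mul_of_pos_left r hpos)⟩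
  refine ⟨s, ?_⟩
  rw [← Function.iterate_add_apply, hs]
  exact (Function.isPeriodicPt_minimalPeriod T.rot x).mul_const r

theorem mem_star_trans {T : PlantedTree} {x y z : T.Dart} (h : y ∈ star x) (h' : z ∈ star y) :
    z ∈ star x := by
  obtain ⟨r, rfl⟩ := h
  obtain ⟨s, rfl⟩ := h'
  exact ⟨s + r, Function.iterate_add_apply _ _ _ _⟩

theorem star_eq_of_mem {T : PlantedTree} {x y : T.Dart} (h : y ∈ star x) : star y = star x :=
  Set.ext fun _ => ⟨mem_star_trans h, mem_star_trans (mem_star_symm h)⟩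

theorem rot_ne_of_mem_star {T : PlantedTree} {x y : T.Dart} (hx : T.rot x ≠ x) (h : y ∈ star x) :
    T.rot y ≠ y := by
  intro hy
  obtain ⟨r, rfl⟩ := mem_star_symm h
  rw [Function.iterate_fixed hy] at hx
  exact hx hy

/-- The half-edges at the leaves in counterclockwise order, starting with the root. -/
def leafDart (T : PlantedTree) (i : ℕ) : T.Dart := T.leafDarts.getD i T.rootDart

theorem length_leafDarts (T : PlantedTree) : T.leafDarts.length = T.vertexCount 1 + 1 := by
  simp [leafDarts, length_leaves]

theorem nextLeaf_leafDart (T : PlantedTree) {i : ℕ} (hi : i < T.vertexCount 1 + 1) :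
    NextLeaf T.rot opp (T.leafDart i) (T.leafDart (i + 1)) := by
  have h := List.isChain_iff_getElem.1 T.isChain_leafDarts i (by simpa [length_leafDarts] using hi)
  rw [← length_leafDarts] at hi
  convert h using 1
  · simp [leafDart, hi]
  · rcases (Nat.succ_le_of_lt hi).lt_or_eq with h' | h'
    · simp [leafDart, h']
    · simp [leafDart, ← h']

/-- The default value in `leafDart` makes the index just past the end denote the root, which closes
the cyclic list of leaves. -/
theorem leafDart_vertexCount (T : PlantedTree) : T.leafDart (T.vertexCount 1 + 1) = T.rootDart := by
  simp [leafDart, ← length_leafDarts]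

theorem exists_leafDart {T : PlantedTree} {x : T.Dart} (hx : T.rot x = x) :
    ∃ i < T.vertexCount 1 + 1, x = T.leafDart i := by
  obtain ⟨i, hi, rfl⟩ := List.getElem_of_mem (mem_leafDarts hx)
  exact ⟨i, by rwa [← length_leafDarts], by simp [leafDart, hi]⟩

theorem nodup_leaves (T : PlantedTree) : T.leaves.Nodup := by
  induction T with
  | node c f ih =>
    cases c with
    | zero => rw [leaves_node_zero]; exact List.nodup_singleton _
    | succ c =>
      rw [leaves_node_succ, List.nodup_flatMap]
      have hinj : ∀ i j (v : (f i).Vertex) (w : (f j).Vertex),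
          liftVertex (f := f) i v = liftVertex j w → i = j ∧ v ≍ w := by
        intro i j v w h
        cases h
        exact ⟨rfl, .rfl⟩
      refine ⟨fun i _ => (ih i).map fun v w h => eq_of_heq (hinj _ _ _ _ h).2, ?_⟩
      refine (List.nodup_finRange _).imp fun {i j} hij => ?_
      intro v hv hv'
      obtain ⟨x, -, rfl⟩ := List.mem_map.1 hv
      obtain ⟨y, -, hy⟩ := List.mem_map.1 hv'
      exact hij (hinj _ _ _ _ hy).1.symm

theorem leafDart_injOn {T : PlantedTree} {i j : ℕ} (hi : i < T.vertexCount 1 + 1)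
    (hj : j < T.vertexCount 1 + 1) (h : T.leafDart i = T.leafDart j) : i = j := by
  have hnd : T.leafDarts.Nodup := by
    refine List.nodup_cons.2 ⟨by simp [rootDart], T.nodup_leaves.map fun v w h => ?_⟩
    cases h; rfl
  rw [← length_leafDarts] at hi hj
  exact (hnd.getElem_inj_iff (hi := hi) (hj := hj)).1 (by simpa [leafDart, hi, hj] using h)

/-- The half-edges at the leaves `h_k`. -/
def headDart (T : PlantedTree) {n : ℕ} (k : Fin n) : T.Dart := T.leafDart (2 * k)

/-- The half-edges at the leaves `t_k`. -/
def tailDart (T : PlantedTree) {n : ℕ} (k : Fin n) : T.Dart := T.leafDart (2 * k + 1)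

section leaves

variable {n : ℕ} {T : PlantedTree} (hn : T.vertexCount 1 + 1 = 2 * n)
include hn

theorem nextLeaf_headDart (k : Fin n) : NextLeaf T.rot opp (T.headDart k) (T.tailDart k) :=
  T.nextLeaf_leafDart (by omega)

theorem nextLeaf_tailDart (k : Fin n) :
    NextLeaf T.rot opp (T.tailDart k) (T.headDart (finRotate n k)) := by
  have h := T.nextLeaf_leafDart (i := 2 * k + 1) (by omega)
  suffices T.headDart (finRotate n k) = T.leafDart (2 * k + 1 + 1) by rw [this]; exact h
  rw [headDart, val_finRotate]
  rcases (Nat.succ_le_of_lt k.2).lt_or_eq with h' | h'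
  · rw [Nat.mod_eq_of_lt h']; rfl
  -- For the last k, the index of the next leaf runs one past the end and returns to the root h₀.
  · rw [← Nat.succ_eq_add_one, h', Nat.mod_self,
      show 2 * (k : ℕ) + 1 + 1 = T.vertexCount 1 + 1 by omega, leafDart_vertexCount]; rfl

theorem headDart_injective : Function.Injective (T.headDart (n := n)) := fun j k h => by
  have := leafDart_injOn (by omega) (by omega) h
  omega

theorem tailDart_injective : Function.Injective (T.tailDart (n := n)) := fun j k h => by
  have := leafDart_injOn (by omega) (by omega) h
  omega

theorem rot_tailDart (k : Fin n) : T.rot (T.tailDart k) = T.tailDart k :=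
  (nextLeaf_headDart hn k).rot_eq

theorem rot_headDart (k : Fin n) : T.rot (T.headDart k) = T.headDart k := by
  have := (nextLeaf_tailDart hn ((finRotate n).symm k)).rot_eq
  rwa [Equiv.apply_symm_apply] at this

theorem exists_headDart_or_tailDart {x : T.Dart} (hx : T.rot x = x) :
    ∃ k : Fin n, x = T.headDart k ∨ x = T.tailDart k := by
  obtain ⟨i, hi, rfl⟩ := exists_leafDart hx
  refine ⟨⟨i / 2, by omega⟩, ?_⟩
  rcases Nat.mod_two_eq_zero_or_one i with h | h
  · exact .inl (congrArg T.leafDart (show i = 2 * (i / 2) by omega))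
  · exact .inr (congrArg T.leafDart (show i = 2 * (i / 2) + 1 by omega))

end leaves

/-! ### Labels -/

namespace IsColoring

variable {T : PlantedTree} {col : T.Dart → Bool} {ht : T.Dart → ℤ} (hc : IsColoring T col ht)
include hc

theorem ht_opp_of_col {x : T.Dart} (hx : col x = true) : ht (opp x) = ht x - 1 := by
  rw [hc.ht_opp, if_pos hx]; rfl

theorem col_step {x : T.Dart} (h : T.rot (opp x) ≠ opp x) : col (T.rot (opp x)) = col x := by
  rw [hc.col_rot _ h, hc.col_opp, Bool.not_not]

theorem ht_step {x : T.Dart} (hx : col x = true) : ht (T.rot (opp x)) = ht x - 1 := by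
  rw [hc.ht_rot, hc.ht_opp_of_col hx]

theorem col_nextLeaf {e z : T.Dart} (h : NextLeaf T.rot opp e z) : col z = !col e := by
  induction h with
  | arrive e _ => exact hc.col_opp e
  | go e z he _ ih => rw [ih, hc.col_step he]

/-- A walk that leaves through an incoming half-edge runs against the edges and loses one unit of
height at each of them. -/
theorem ht_nextLeaf {e z : T.Dart} (h : NextLeaf T.rot opp e z) (he : col e = true) :
    ht z < ht e := by
  induction h with
  | arrive e _ => rw [hc.ht_opp_of_col he]; omega
  | go e z he' _ ih =>
    have := ih (by rw [hc.col_step he', he])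
    rw [hc.ht_step he] at this
    omega

/-- Equal heights and a common end force walks of equal length. They can be retraced simultaneously
because each step is injective. -/
theorem eq_of_nextLeaf {e e' z : T.Dart} (h : NextLeaf T.rot opp e z)
    (h' : NextLeaf T.rot opp e' z) (he : col e = true) (he' : col e' = true)
    (hht : ht e = ht e') : e = e' := by
  induction h generalizing e' with
  | arrive e hs =>
    generalize hz : opp e = z at h'
    cases h' with
    | arrive _ hs' => exact opp_injective hz
    | go _ _ hs' hg =>
      have := hc.ht_nextLeaf hg (by rw [hc.col_step hs', he'])
      rw [hc.ht_step he', ← hz, hc.ht_opp_of_col he] at this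
      omega
  | go e z hs hg ih =>
    cases h' with
    | arrive _ hs' =>
      have := hc.ht_nextLeaf hg (by rw [hc.col_step hs, he])
      rw [hc.ht_step he, hc.ht_opp_of_col he'] at this
      omega
    | go _ _ hs' hg' =>
      have := ih hg' (by rw [hc.col_step hs, he]) (by rw [hc.col_step hs', he'])
        (by rw [hc.ht_step he, hc.ht_step he', hht])
      exact opp_injective (T.rot_injective this)

theorem exists_nextLeaf {e : T.Dart} (he : col e = true) : ∃ z, NextLeaf T.rot opp e z := by
  -- Heights take finitely many values and decrease along the walk, so the walk stops.
  obtain ⟨B, hB⟩ : ∃ B, ∀ x, B ≤ ht x := by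
    obtain ⟨B, hB⟩ := (Set.finite_range ht).bddBelow
    exact ⟨B, fun x => hB ⟨x, rfl⟩⟩
  generalize hm : (ht e - B).toNat = m
  induction m using Nat.strong_induction_on generalizing e with
  | _ m ih =>
    by_cases h : T.rot (opp e) = opp e
    · exact ⟨_, .arrive e h⟩
    · have h1 := hB (T.rot (opp e))
      rw [hc.ht_step he] at h1
      obtain ⟨z, hz⟩ := ih (ht (T.rot (opp e)) - B).toNat (by rw [hc.ht_step he]; omega)
        (by rw [hc.col_step h, he]) rfl
      exact ⟨z, .go _ _ h hz⟩

section labels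

variable {n : ℕ} (hn : T.vertexCount 1 + 1 = 2 * n) (hroot : col T.rootDart = true)
include hn hroot

theorem col_leafDart {i : ℕ} (hi : i < 2 * n) : col (T.leafDart i) = decide (Even i) := by
  induction i with
  | zero => exact hroot
  | succ i ih =>
    rw [hc.col_nextLeaf (T.nextLeaf_leafDart (i := i) (by omega)), ih (by omega)]
    by_cases h : Even i <;> simp [h, Nat.even_add_one]

theorem col_headDart (k : Fin n) : col (T.headDart k) = true := by
  rw [headDart, hc.col_leafDart hn hroot (by omega)]; simp

theorem col_tailDart (k : Fin n) : col (T.tailDart k) = false := by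
  rw [tailDart, hc.col_leafDart hn hroot (by omega)]; simp

theorem eq_tailDart {x : T.Dart} (hx : T.rot x = x) (h : col x = false) :
    ∃ k : Fin n, x = T.tailDart k := by
  obtain ⟨k, rfl | rfl⟩ := exists_headDart_or_tailDart hn hx
  · rw [hc.col_headDart hn hroot] at h; cases h
  · exact ⟨k, rfl⟩

theorem eq_headDart {x : T.Dart} (hx : T.rot x = x) (h : col x = true) :
    ∃ k : Fin n, x = T.headDart k := by
  obtain ⟨k, rfl | rfl⟩ := exists_headDart_or_tailDart hn hx
  · exact ⟨k, rfl⟩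
  · rw [hc.col_tailDart hn hroot] at h; cases h

/-- Every incoming half-edge has a label. -/
theorem exists_label {e : T.Dart} (he : col e = true) :
    ∃ k : Fin n, NextLeaf T.rot opp e (T.tailDart k) := by
  obtain ⟨z, hz⟩ := hc.exists_nextLeaf he
  obtain ⟨k, rfl⟩ := hc.eq_tailDart hn hroot hz.rot_eq (by rw [hc.col_nextLeaf hz, he]; rfl)
  exact ⟨k, hz⟩

end labels

end IsColoring

end PlantedTree

namespace PlantedTree

/-! ### The factorization of a tree -/

/-- The internal vertices of a tree, as sets of half-edges. -/
def Inner (T : PlantedTree) : Type := {S : Set T.Dart // ∃ x, T.rot x ≠ x ∧ S = star x}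

instance (T : PlantedTree) : Finite T.Inner := Subtype.finite

/-- The internal vertex that carries a given half-edge. -/
def Inner.mk {T : PlantedTree} (x : T.Dart) (hx : T.rot x ≠ x) : T.Inner := ⟨star x, x, hx, rfl⟩

theorem Inner.eq_mk {T : PlantedTree} (S : T.Inner) {x : T.Dart} (hx : T.rot x ≠ x)
    (h : x ∈ S.1) : S = Inner.mk x hx := by
  obtain ⟨_, y, hy, rfl⟩ := S
  exact Subtype.ext (star_eq_of_mem h).symm

theorem Inner.rot_ne {T : PlantedTree} (S : T.Inner) {x : T.Dart} (h : x ∈ S.1) : T.rot x ≠ x := by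
  obtain ⟨_, y, hy, rfl⟩ := S
  exact rot_ne_of_mem_star hy h

theorem Inner.rot_mem {T : PlantedTree} (S : T.Inner) {x : T.Dart} (h : x ∈ S.1) :
    T.rot x ∈ S.1 := by
  obtain ⟨_, y, hy, rfl⟩ := S
  exact rot_mem_star h

theorem Inner.exists_iterate {T : PlantedTree} (S : T.Inner) {x y : T.Dart} (hx : x ∈ S.1)
    (hy : y ∈ S.1) : ∃ r, T.rot^[r] x = y := by
  obtain ⟨_, z, hz, rfl⟩ := S
  exact mem_star_trans (mem_star_symm hx) hy

theorem Inner.ht_eq {T : PlantedTree} {col : T.Dart → Bool} {ht : T.Dart → ℤ}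
    (hc : IsColoring T col ht) (S : T.Inner) {x y : T.Dart} (hx : x ∈ S.1) (hy : y ∈ S.1) :
    ht x = ht y := by
  obtain ⟨r, rfl⟩ := S.exists_iterate hx hy
  induction r with
  | zero => rfl
  | succ r ih =>
    rw [Function.iterate_succ_apply', hc.ht_rot]
    refine ih ?_
    clear ih hy
    induction r with
    | zero => exact hx
    | succ r ih => rw [Function.iterate_succ_apply']; exact S.rot_mem ih

/-- The type excludes vertices of degree two. This is why the cycle around an internal vertex moves
all of its labels. -/
theorem HasType.rot_rot_ne {n : ℕ} {α : ℕ →₀ ℕ} {T : PlantedTree} (hT : T.HasType n α)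
    {x : T.Dart} (hx : T.rot x ≠ x) : T.rot (T.rot x) ≠ x := by
  classical
  intro h2
  have hle : Function.minimalPeriod T.rot x ≤ 2 :=
    Function.IsPeriodicPt.minimalPeriod_le (n := 2) (by omega) h2
  have hne : Function.minimalPeriod T.rot x ≠ 1 := fun h =>
    hx (Function.minimalPeriod_eq_one_iff_isFixedPt.1 h)
  have hcard := T.card_minimalPeriod (Function.minimalPeriod T.rot x)
  have hpos : 0 < Fintype.card
      {y : T.Dart // Function.minimalPeriod T.rot y = Function.minimalPeriod T.rot x} :=
    Fintype.card_pos_iff.2 ⟨⟨x, rfl⟩⟩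
  rw [hcard, if_neg hne, add_zero] at hpos
  obtain h | ⟨j, hj, h⟩ := hT.only _ (Nat.pos_of_mul_pos_left hpos).ne' <;> omega

theorem HasType.isEven {n : ℕ} {α : ℕ →₀ ℕ} {T : PlantedTree} (hT : T.HasType n α) :
    T.IsEven := fun d hd => by
  obtain h | ⟨j, -, rfl⟩ := hT.only d hd
  exacts [.inl h, .inr (even_two_mul j)]

section factor

variable {n : ℕ} {α : ℕ →₀ ℕ} {T : PlantedTree} {col : T.Dart → Bool} {ht : T.Dart → ℤ}

/-- The permutation `σ` is the cycle of the labels around the internal vertex `S`. -/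
structure IsLabelCycle (col : T.Dart → Bool) (S : T.Inner) (σ : Equiv.Perm (Fin n)) : Prop where
  label : ∀ e ∈ S.1, col e = true → ∀ k : Fin n, NextLeaf T.rot opp e (T.tailDart k) →
    NextLeaf T.rot opp (T.rot (T.rot e)) (T.tailDart (σ k))
  fixed : ∀ k : Fin n,
    (∀ e ∈ S.1, col e = true → ¬ NextLeaf T.rot opp e (T.tailDart k)) → σ k = k

theorem IsColoring.col_rot_rot (hc : IsColoring T col ht) (S : T.Inner) {e : T.Dart}
    (he : e ∈ S.1) : col (T.rot (T.rot e)) = col e := by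
  rw [hc.col_rot _ (S.rot_ne (S.rot_mem he)), hc.col_rot _ (S.rot_ne he), Bool.not_not]

/-- Turning by two permutes the incoming half-edges at a vertex. They share one height, so their
labels are distinct and this permutation transfers to the labels. -/
theorem exists_isLabelCycle (hT : T.HasType n α) (hc : IsColoring T col ht)
    (hroot : col T.rootDart = true) (S : T.Inner) :
    ∃ σ : Equiv.Perm (Fin n), IsLabelCycle col S σ := by
  let A := {e : T.Dart // e ∈ S.1 ∧ col e = true}
  let next : A → A := fun e => ⟨T.rot (T.rot e.1), S.rot_mem (S.rot_mem e.2.1), by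
    rw [hc.col_rot_rot S e.2.1, e.2.2]⟩
  have hnext : Function.Injective next := fun a b h =>
    Subtype.ext (T.rot_injective (T.rot_injective (congrArg Subtype.val h)))
  let τ : Equiv.Perm A := Equiv.ofBijective next (Finite.injective_iff_bijective.1 hnext)
  choose lab hlab using fun e : A => hc.exists_label hT.leaves hroot e.2.2
  have hinj : Function.Injective lab := by
    intro a b h
    have h1 := hlab a
    rw [h] at h1
    exact Subtype.ext (hc.eq_of_nextLeaf h1 (hlab b) a.2.2 b.2.2 (S.ht_eq hc a.2.1 b.2.1))
  have huniq : ∀ (e : A) (k : Fin n), NextLeaf T.rot opp e.1 (T.tailDart k) → k = lab e :=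
    fun e k h => tailDart_injective hT.leaves (h.unique (hlab e))
  refine ⟨τ.viaEmbedding ⟨lab, hinj⟩, fun e he hcol k hk => ?_, fun k hk => ?_⟩
  · obtain rfl := huniq ⟨e, he, hcol⟩ k hk
    have := τ.viaEmbedding_apply ⟨lab, hinj⟩ ⟨e, he, hcol⟩
    simp only [Function.Embedding.coeFn_mk] at this
    rw [this]
    exact hlab (next ⟨e, he, hcol⟩)
  · refine τ.viaEmbedding_apply_of_notMem _ _ ?_
    rintro ⟨e, rfl⟩
    exact hk e.1 e.2.1 e.2.2 (hlab e)

namespace IsLabelCycle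

variable {S : T.Inner} {σ : Equiv.Perm (Fin n)} (hσ : IsLabelCycle col S σ)
include hσ

theorem apply_ne_iff (hT : T.HasType n α) (hc : IsColoring T col ht) (k : Fin n) :
    σ k ≠ k ↔ ∃ e ∈ S.1, col e = true ∧ NextLeaf T.rot opp e (T.tailDart k) := by
  constructor
  · intro h
    by_contra! h'
    exact h (hσ.fixed k h')
  · rintro ⟨e, he, hcol, hk⟩ h
    have h1 := hσ.label e he hcol k hk
    rw [h] at h1
    refine hT.rot_rot_ne (S.rot_ne he) (hc.eq_of_nextLeaf h1 hk ?_ hcol ?_)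
    · rw [hc.col_rot_rot S he, hcol]
    · rw [hc.ht_rot, hc.ht_rot]

theorem isCycle (hT : T.HasType n α) (hc : IsColoring T col ht)
    (hroot : col T.rootDart = true) : σ.IsCycle := by
  obtain ⟨e, he, hcol⟩ : ∃ e ∈ S.1, col e = true := by
    obtain ⟨_, x, hx, rfl⟩ := S
    by_cases h : col x = true
    · exact ⟨x, mem_star_self x, h⟩
    · exact ⟨T.rot x, rot_mem_star (mem_star_self x), by rw [hc.col_rot x hx]; simpa using h⟩
  obtain ⟨k, hk⟩ := hc.exists_label hT.leaves hroot hcol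
  have hiter : ∀ r, T.rot^[r] e ∈ S.1 ∧ col (T.rot^[r] e) = decide (Even r) := by
    intro r
    induction r with
    | zero => exact ⟨he, by simpa using hcol⟩
    | succ r ih =>
      rw [Function.iterate_succ_apply', hc.col_rot _ (S.rot_ne ih.1), ih.2]
      refine ⟨S.rot_mem ih.1, ?_⟩
      by_cases h : Even r <;> simp [h, Nat.even_add_one]
  have hlab : ∀ s, NextLeaf T.rot opp (T.rot^[2 * s] e) (T.tailDart ((σ ^ s) k)) := by
    intro s
    induction s with
    | zero => exact hk
    | succ s ih =>
      rw [Nat.mul_succ, Function.iterate_succ_apply', Function.iterate_succ_apply', pow_succ',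
        Equiv.Perm.mul_apply]
      exact hσ.label _ (hiter _).1 (by rw [(hiter _).2]; simp) _ ih
  refine ⟨k, (hσ.apply_ne_iff hT hc k).2 ⟨e, he, hcol, hk⟩, fun y hy => ?_⟩
  obtain ⟨e', he', hcol', hy'⟩ := (hσ.apply_ne_iff hT hc y).1 hy
  obtain ⟨r, rfl⟩ := S.exists_iterate he he'
  rw [(hiter r).2, decide_eq_true_eq] at hcol'
  obtain ⟨s, rfl⟩ := hcol'.two_dvd
  exact ⟨s, by simpa using tailDart_injective hT.leaves ((hlab s).unique hy')⟩

end IsLabelCycle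

end factor

/-- A list of the internal vertices in an order that is compatible with the heights. -/
theorem exists_sorted_inner (T : PlantedTree) (h : T.Inner → ℤ) :
    ∃ (m : ℕ) (w : Fin m ≃ T.Inner), Monotone fun i => h (w i) := by
  obtain ⟨m, ⟨e⟩⟩ := Finite.exists_equiv_fin T.Inner
  exact ⟨m, (Tuple.sort (h ∘ e.symm)).trans e.symm, Tuple.monotone_sort (h ∘ e.symm)⟩

section tree

variable {n : ℕ} {α : ℕ →₀ ℕ} {T : PlantedTree} {col : T.Dart → Bool} {ht : T.Dart → ℤ}

/-- Incoming half-edges are matched by vertex and label, outgoing ones through the incoming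
half-edge that follows them. What needs proof is that the paths in the product are those in the
tree: heights rise by one along tree edges, and the factors are listed by weakly increasing height.
-/
theorem exists_dartEquiv_of_isLabelCycle (hT : T.HasType n α) (hc : IsColoring T col ht)
    (hroot : col T.rootDart = true) {l : List (Equiv.Perm (Fin n))} (w : Fin l.length ≃ T.Inner)
    (hl : ∀ i, IsLabelCycle col (w i) (l.get i))
    (hmono : ∀ i j, i ≤ j → ∀ x ∈ (w i).1, ∀ y ∈ (w j).1, ht x ≤ ht y) :
    ∃ φ : ProductDart l ≃ T.Dart, (∀ d, φ d.rot = T.rot (φ d)) ∧ (∀ d, φ d.opp = opp (φ d)) ∧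
      (∀ k, φ (.head k) = T.headDart k) ∧ ∀ k, φ (.tail k) = T.tailDart k := by
  have hn := hT.leaves
  choose E hE hEc hEk using fun (i : Fin l.length) (k : Fin n) (hk : l.get i k ≠ k) =>
    ((hl i).apply_ne_iff hT hc k).1 hk
  -- Every incoming half-edge at an internal vertex is some `E i k`, since label and height
  -- determine it.
  have hmoves : ∀ {e : T.Dart} {k : Fin n} (hr : T.rot e ≠ e), col e = true →
      NextLeaf T.rot opp e (T.tailDart k) →
      ∃ (i : Fin l.length) (hk : l.get i k ≠ k), e = E i k hk := by
    intro e k hr he hk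
    have hmem : e ∈ (w (w.symm (Inner.mk e hr))).1 := by
      rw [Equiv.apply_symm_apply]; exact mem_star_self e
    have hk' := ((hl (w.symm (Inner.mk e hr))).apply_ne_iff hT hc k).2 ⟨e, hmem, he, hk⟩
    exact ⟨_, hk', hc.eq_of_nextLeaf hk (hEk _ _ hk') he (hEc _ _ _)
      (Inner.ht_eq hc _ hmem (hE _ _ _))⟩
  have hwE : ∀ {i j k k'} {hk : l.get i k ≠ k} {hk' : l.get j k' ≠ k'},
      (∃ r, T.rot^[r] (E i k hk) = E j k' hk') → i = j := by
    rintro i j k k' hk hk' ⟨r, hr⟩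
    have hr1 := (w i).rot_ne (hE i k hk)
    have hr2 := (w j).rot_ne (hE j k' hk')
    apply w.injective
    rw [(w i).eq_mk hr1 (hE _ _ _), (w j).eq_mk hr2 (hE _ _ _)]
    exact Subtype.ext (star_eq_of_mem ⟨r, hr⟩).symm
  have hlabel : ∀ {i j k k'} {hk : l.get i k ≠ k} {hk' : l.get j k' ≠ k'},
      E i k hk = E j k' hk' → k = k' := by
    intro i j k k' hk hk' h
    have h1 := hEk i k hk
    rw [h] at h1
    exact tailDart_injective hn (h1.unique (hEk j k' hk'))
  let O : ∀ (i : Fin l.length) (k : Fin n), l.get i k ≠ k → T.Dart := fun i k hk =>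
    T.rotPerm.symm (E i k hk)
  have hO : ∀ i k hk, T.rot (O i k hk) = E i k hk := fun i k hk => rot_rotPerm_symm _
  have hOr : ∀ i k hk, T.rot (O i k hk) ≠ O i k hk := by
    intro i k hk h
    refine (w i).rot_ne (hE i k hk) ?_
    conv_lhs => rw [← hO i k hk, h, hO]
  have hOc : ∀ i k hk, col (O i k hk) = false := by
    intro i k hk
    have := hc.col_rot _ (hOr i k hk)
    rw [hO, hEc] at this
    simpa using this.symm
  have hEE : ∀ i k hk hk', E i (l.get i k) hk' = T.rot (T.rot (E i k hk)) := by
    intro i k hk hk'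
    refine hc.eq_of_nextLeaf (hEk _ _ _) ((hl i).label _ (hE i k hk) (hEc _ _ _) k (hEk _ _ _))
      (hEc _ _ _) ?_ ?_
    · rw [hc.col_rot_rot _ (hE i k hk), hEc]
    · rw [hc.ht_rot, hc.ht_rot]
      exact Inner.ht_eq hc _ (hE _ _ _) (hE _ _ _)
  let g : ProductDart l → T.Dart := fun d =>
    match d with
    | .tail k => T.tailDart k
    | .head k => T.headDart k
    | .inc i k hk => E i k hk
    | .out i k hk => O i k hk
  have hgrot : ∀ d, g d.rot = T.rot (g d) := by
    intro d
    cases d with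
    | tail k => exact (rot_tailDart hn k).symm
    | head k => exact (rot_headDart hn k).symm
    | out i k hk => exact (hO i k hk).symm
    | inc i k hk => exact T.rot_injective ((hO _ _ _).trans (hEE _ _ _ _))
  have hgarrow : ∀ d d' : ProductDart l, d.Arrow d' → opp (g d') = g d := by
    have h_arrive : ∀ {e : T.Dart} {k : Fin n}, col e = true →
        NextLeaf T.rot opp e (T.tailDart k) → T.rot (opp e) = opp e → opp e = T.tailDart k :=
      fun _ hk h => (NextLeaf.arrive _ h).unique hk
    -- One step back from an incoming half-edge labelled k either meets t_k or an outgoing half-edge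
    -- labelled k whose height is one lower.
    have hstep : ∀ {e : T.Dart} {k : Fin n}, col e = true →
        NextLeaf T.rot opp e (T.tailDart k) → T.rot (opp e) ≠ opp e →
        ∃ i hk, opp e = O i k hk ∧ ht (E i k hk) = ht e - 1 := by
      intro e k he hk h
      have hk' : NextLeaf T.rot opp (T.rot (opp e)) (T.tailDart k) := hk.of_ne h
      obtain ⟨i, hi, hEi⟩ := hmoves (fun h' => h (T.rot_injective h'))
        (by rw [hc.col_step h, he]) hk'
      refine ⟨i, hi, T.rot_injective (by rw [hO, hEi]), ?_⟩
      rw [← hEi, hc.ht_step he]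
    have hlt : ∀ {i j k} {hi : l.get i k ≠ k} {hj : l.get j k ≠ k},
        ht (E i k hi) < ht (E j k hj) → i < j := by
      intro i j k hi hj h
      by_contra! h'
      exact absurd (hmono j i h' _ (hE _ _ _) _ (hE _ _ _)) (not_le.2 h)
    intro d d' h
    cases h with
    | tail_head k h =>
      have hcol := hc.col_headDart hn hroot k
      by_cases hs : T.rot (opp (T.headDart k)) = opp (T.headDart k)
      · exact h_arrive hcol (nextLeaf_headDart hn k) hs
      · obtain ⟨i, hk, -⟩ := hstep hcol (nextLeaf_headDart hn k) hs
        exact absurd (h i) hk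
    | tail_inc j k hj h =>
      by_cases hs : T.rot (opp (E j k hj)) = opp (E j k hj)
      · exact h_arrive (hEc _ _ _) (hEk j k hj) hs
      · obtain ⟨i, hk, -, hht⟩ := hstep (hEc _ _ _) (hEk j k hj) hs
        exact absurd (h i (hlt (by rw [hht]; omega))) hk
    | out_head i k hi h =>
      have hcol := hc.col_headDart hn hroot k
      have hcol' : col (opp (O i k hi)) = true := by rw [hc.col_opp, hOc]; rfl
      have hk' : NextLeaf T.rot opp (opp (O i k hi)) (T.tailDart k) :=
        .go _ _ (by rw [opp_opp]; exact hOr i k hi) (by rw [opp_opp, hO]; exact hEk i k hi)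
      rw [← opp_opp (g (.out i k hi))]
      congr 1
      by_cases hs : T.rot (opp (O i k hi)) = opp (O i k hi)
      · obtain ⟨k', hk''⟩ := hc.eq_headDart hn hroot hs hcol'
        have h1 := nextLeaf_headDart hn k'
        rw [← hk''] at h1
        obtain rfl := tailDart_injective hn (h1.unique hk')
        exact hk''.symm
      -- Otherwise the edge would lead to a higher factor that moves k, hence to one later in the
      -- list.
      · obtain ⟨j, hj, hEj⟩ := hmoves hs hcol' hk'
        refine absurd (h j (hlt (hi := hi) (hj := hj) ?_)) hj
        rw [← hEj, hc.ht_opp, hOc, ← hc.ht_rot (O i k hi), hO]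
        simp
    | out_inc i j k hi hj hij h =>
      have hle := hmono i j hij.le _ (hE i k hi) _ (hE j k hj)
      have hne : ht (E i k hi) ≠ ht (E j k hj) := by
        intro heq
        have := hc.eq_of_nextLeaf (hEk i k hi) (hEk j k hj) (hEc _ _ _) (hEc _ _ _) heq
        exact hij.ne (hwE ⟨0, this⟩)
      by_cases hs : T.rot (opp (E j k hj)) = opp (E j k hj)
      · have h1 := h_arrive (hEc _ _ _) (hEk j k hj) hs
        have h2 := hc.ht_nextLeaf (hEk i k hi) (hEc _ _ _)
        rw [← h1, hc.ht_opp_of_col (hEc _ _ _)] at h2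
        omega
      · obtain ⟨i', hi', hO', hht⟩ := hstep (hEc _ _ _) (hEk j k hj) hs
        -- The tree predecessor i' lies one level below j, and i lies between them in the list but
        -- strictly below j in height. So i and i' have equal height and the same label.
        suffices i' = i by subst this; exact hO'
        have h1 : i' < j := hlt (hi := hi') (hj := hj) (by rw [hht]; omega)
        have h2 : i' ≤ i := by
          by_contra! h'
          exact hi' (h i' h' h1)
        have h3 := hmono i' i h2 _ (hE i' k hi') _ (hE i k hi)
        have h4 : ht (E i' k hi') = ht (E i k hi) := by omega
        exact hwE ⟨0, hc.eq_of_nextLeaf (hEk i' k hi') (hEk i k hi) (hEc _ _ _) (hEc _ _ _) h4⟩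
  have hgopp : ∀ d, g d.opp = opp (g d) := by
    intro d
    rcases d.opp_spec with h | h
    · rw [← hgarrow _ _ h, opp_opp]
    · rw [hgarrow _ _ h]
  have hginj : Function.Injective g := by
    have hleaf : ∀ {i k hk k'}, E i k hk ≠ T.headDart (n := n) k' := by
      intro i k hk k' h
      exact (w i).rot_ne (hE i k hk) (by rw [h, rot_headDart hn])
    have hleaf' : ∀ {i k hk k'}, O i k hk ≠ T.tailDart (n := n) k' := by
      intro i k hk k' h
      exact hOr i k hk (by rw [h, rot_tailDart hn])
    have hcg : ∀ d, col (g d) =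
        match d with
        | .tail _ => false
        | .head _ => true
        | .inc _ _ _ => true
        | .out _ _ _ => false := by
      intro d
      cases d with
      | tail k => exact hc.col_tailDart hn hroot k
      | head k => exact hc.col_headDart hn hroot k
      | inc i k hk => exact hEc i k hk
      | out i k hk => exact hOc i k hk
    have hEinj : ∀ {i j k k'} {hk : l.get i k ≠ k} {hk' : l.get j k' ≠ k'},
        E i k hk = E j k' hk' → i = j ∧ k = k' := fun h => ⟨hwE ⟨0, h⟩, hlabel h⟩
    intro d d' h
    have hcol := congrArg col h
    rw [hcg, hcg] at hcol
    cases d <;> cases d' <;> simp only [reduceCtorEq] at hcol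
    · rw [tailDart_injective hn h]
    · exact absurd h.symm hleaf'
    · rw [headDart_injective hn h]
    · exact absurd h.symm hleaf
    · exact absurd h hleaf
    · obtain ⟨rfl, rfl⟩ := hEinj h; rfl
    · exact absurd h hleaf'
    · have h' := congrArg T.rot h
      rw [hO, hO] at h'
      obtain ⟨rfl, rfl⟩ := hEinj h'; rfl
  have hgsurj : Function.Surjective g := by
    have hin : ∀ e, col e = true → T.rot e ≠ e → ∃ i k hk, e = E i k hk := by
      intro e he hr
      obtain ⟨k, hk⟩ := hc.exists_label hn hroot he
      obtain ⟨i, hi, h⟩ := hmoves hr he hk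
      exact ⟨i, k, hi, h⟩
    intro e
    by_cases hr : T.rot e = e
    · obtain ⟨k, rfl | rfl⟩ := exists_headDart_or_tailDart hn hr
      exacts [⟨.head k, rfl⟩, ⟨.tail k, rfl⟩]
    · by_cases he : col e = true
      · obtain ⟨i, k, hk, rfl⟩ := hin e he hr
        exact ⟨.inc i k hk, rfl⟩
      · obtain ⟨i, k, hk, h⟩ := hin (T.rot e) (by rw [hc.col_rot e hr]; simpa using he)
          fun h => hr (T.rot_injective h)
        exact ⟨.out i k hk, T.rot_injective ((hO i k hk).trans h.symm)⟩
  exact ⟨Equiv.ofBijective g ⟨hginj, hgsurj⟩, hgrot, hgopp, fun _ => rfl, fun _ => rfl⟩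

/-- Every plane tree of type `α` is the tree of a minimal factorization of type `α`. -/
theorem HasType.exists_isTreeOfProduct [NeZero n] (hT : T.HasType n α) :
    ∃ l : List (Equiv.Perm (Fin n)), IsMinimalFactorization n α l ∧ T.IsTreeOfProduct l := by
  obtain ⟨col, ht, hc, hroot, -⟩ := exists_isColoring hT.isEven true 0
  -- Vertices of equal height may be listed in any order.
  obtain ⟨m, v, hv⟩ := T.exists_sorted_inner fun S => ht S.2.choose
  have hmem : ∀ S : T.Inner, S.2.choose ∈ S.1 := fun S =>
    (Set.ext_iff.1 S.2.choose_spec.2 _).2 (mem_star_self _)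
  choose σ hσ using fun S => exists_isLabelCycle hT hc hroot S
  obtain ⟨l, w, hl, hmono⟩ : ∃ (l : List (Equiv.Perm (Fin n))) (w : Fin l.length ≃ T.Inner),
      (∀ i, l.get i = σ (w i)) ∧ ∀ i j, i ≤ j → ht (w i).2.choose ≤ ht (w j).2.choose := by
    refine ⟨List.ofFn fun i => σ (v i), (finCongr (by simp)).trans v, ?_, ?_⟩
    · intro i; simp; rfl
    · intro i j hij; exact hv (by simpa using hij)
  have hl' : ∀ i, IsLabelCycle col (w i) (l.get i) := fun i => by rw [hl]; exact hσ _
  obtain ⟨φ, h1, h2, h3, h4⟩ := exists_dartEquiv_of_isLabelCycle hT hc hroot w hl' (by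
    intro i j hij x hx y hy
    rw [Inner.ht_eq hc _ hx (hmem _), Inner.ht_eq hc _ hy (hmem _)]
    exact hmono i j hij)
  have htree : T.IsTreeOfProduct l := isTreeOfProduct_iff.2 ⟨φ, h1, h2, h3 0⟩
  refine ⟨l, htree.isMinimalFactorization hT (fun τ hτ => ?_) (Equiv.ext fun k => ?_), htree⟩
  · obtain ⟨i, rfl⟩ := List.get_of_mem hτ
    exact (hl' i).isCycle hT hc hroot
  -- The walk from t_k ends at the image of k under the product, while in the tree it ends at the
  -- next h-leaf; the two ends agree.
  · have h5 := (ProductDart.nextLeaf_tail (l := l) k).map φ.injective h1 h2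
    rw [h3, h4] at h5
    exact headDart_injective hT.leaves (h5.unique (nextLeaf_tailDart hT.leaves k))

end tree

end PlantedTree

/-! ### Moving commuting factors -/

theorem CommutationMove.cons {n : ℕ} {l l' : List (Equiv.Perm (Fin n))} (σ : Equiv.Perm (Fin n))
    (h : CommutationMove l l') : CommutationMove (σ :: l) (σ :: l') := by
  obtain ⟨a, b, τ, τ', hc, rfl, rfl⟩ := h
  exact ⟨σ :: a, b, τ, τ', hc, rfl, rfl⟩

theorem eqvGen_commutationMove_cons {n : ℕ} {l l' : List (Equiv.Perm (Fin n))}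
    (σ : Equiv.Perm (Fin n)) (h : Relation.EqvGen CommutationMove l l') :
    Relation.EqvGen CommutationMove (σ :: l) (σ :: l') := by
  induction h with
  | rel _ _ h => exact .rel _ _ (h.cons σ)
  | refl => exact .refl _
  | symm _ _ _ ih => exact .symm _ _ ih
  | trans _ _ _ _ _ ih ih' => exact .trans _ _ _ ih ih'

theorem eqvGen_commutationMove_middle {n : ℕ} (a b : List (Equiv.Perm (Fin n)))
    (σ : Equiv.Perm (Fin n)) (h : ∀ τ ∈ a, Commute τ σ) :
    Relation.EqvGen CommutationMove (a ++ σ :: b) (σ :: (a ++ b)) := by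
  induction a with
  | nil => exact .refl _
  | cons τ a ih =>
    refine .trans _ _ _ (eqvGen_commutationMove_cons τ
      (ih fun τ' hτ' => h τ' (List.mem_cons_of_mem _ hτ'))) (.rel _ _ ?_)
    exact ⟨[], a ++ b, τ, σ, h τ List.mem_cons_self, rfl, rfl⟩

namespace PlantedTree

/-! ### Stripping the tree of a product -/

section strip

variable {n : ℕ} {l : List (Equiv.Perm (Fin n))} {T : PlantedTree}

theorem initialStage_lab (hn : T.vertexCount 1 + 1 = 2 * n) (e : T.Dart) (k : Fin n) :
    (initialStage n T).lab e k ↔ opp e = T.tailDart k := by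
  have hk : 2 * (k : ℕ) < T.leaves.length := by rw [length_leaves]; omega
  have h : T.tailDart k = .up (T.leaves[2 * (k : ℕ)]) := by
    simp [tailDart, leafDart, leafDarts, hk]
  simp only [initialStage, List.getElem?_eq_getElem hk, Option.some.injEq, exists_eq_left', h]

/-- The labels and the half-edges at a stage of the stripping procedure in which the factors with
indices in `G` have been removed. -/
structure Stripped (φ : ProductDart l ≃ T.Dart) (s : Stage n T) (G : Set (Fin l.length)) :
    Prop where
  gone : ∀ d, φ d ∈ s.gone ↔ ∃ i ∈ G, d.vtx = .inr i
  closed : ∀ i j k, i < j → l.get i k ≠ k → l.get j k ≠ k → j ∈ G → i ∈ G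
  lab_inc : ∀ j ∉ G, ∀ k hk k', s.lab (φ (.inc j k hk)) k' ↔
    k' = k ∧ ∀ r, r < j → l.get r k ≠ k → r ∈ G
  lab_out : ∀ j ∉ G, ∀ k hk m, ¬ s.lab (φ (.out j k hk)) m

/-- All factors that have to precede the `i`-th one are in `G`, but not this one itself. -/
def Ready (G : Set (Fin l.length)) (i : Fin l.length) : Prop :=
  i ∉ G ∧ ∀ k, l.get i k ≠ k → ∀ r, r < i → l.get r k ≠ k → r ∈ G

theorem exists_ready {G : Set (Fin l.length)} (h : G ≠ Set.univ) : ∃ i, Ready G i := by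
  obtain ⟨i, hi⟩ := (Set.ne_univ_iff_exists_notMem G).1 h
  obtain ⟨j, hj, hmin⟩ := ProductDart.exists_first (p := fun i => i ∉ G) ⟨i, hi⟩
  exact ⟨j, hj, fun k _ r hr _ => not_not.1 (hmin r hr)⟩

variable {φ : ProductDart l ≃ T.Dart}

/-- Matching the root suffices: alternating walks from h to t and from t to h reach every leaf in
both maps. -/
theorem headDart_eq_tailDart_eq [NeZero n] (hn : T.vertexCount 1 + 1 = 2 * n)
    (hprod : l.reverse.prod = finRotate n) (hrot : ∀ d, φ d.rot = T.rot (φ d))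
    (hopp : ∀ d, φ d.opp = opp (φ d)) (hroot : φ (.head 0) = T.rootDart) (k : Fin n) :
    φ (.head k) = T.headDart k ∧ φ (.tail k) = T.tailDart k := by
  have htail : ∀ k, φ (.head k) = T.headDart k → φ (.tail k) = T.tailDart k := by
    intro k hk
    have h := (ProductDart.nextLeaf_head (l := l) k).map φ.injective hrot hopp
    rw [hk] at h
    exact h.unique (nextLeaf_headDart hn k)
  have hhead : ∀ m : ℕ, φ (.head ((finRotate n ^ m) 0)) = T.headDart ((finRotate n ^ m) 0) := by
    intro m
    induction m with
    | zero => exact hroot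
    | succ m ih =>
      have h := (ProductDart.nextLeaf_tail (l := l) ((finRotate n ^ m) 0)).map φ.injective hrot hopp
      rw [htail _ ih, hprod] at h
      rw [pow_succ', Equiv.Perm.mul_apply]
      exact h.unique (nextLeaf_tailDart hn _)
  have hk : (finRotate n ^ (k : ℕ)) 0 = k := by
    ext
    rw [val_finRotate_pow, Fin.val_zero, zero_add, Nat.mod_eq_of_lt k.2]
  have := hhead k
  rw [hk] at this
  exact ⟨this, htail k this⟩

theorem stripped_initialStage (hn : T.vertexCount 1 + 1 = 2 * n)
    (hopp : ∀ d, φ d.opp = opp (φ d)) (htail : ∀ k, φ (.tail k) = T.tailDart k) :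
    Stripped φ (initialStage n T) ∅ where
  gone d := by simp [initialStage]
  closed := by simp
  lab_inc j _ k hk k' := by
    rw [initialStage_lab hn, ← htail, ← hopp, φ.apply_eq_iff_eq, ProductDart.opp_eq_iff]
    constructor
    · rintro (h | h)
      · cases h
      · cases h with
        | tail_inc _ _ _ h => exact ⟨rfl, fun r hr hr' => absurd (h r hr) hr'⟩
    · rintro ⟨rfl, h⟩
      exact .inr (.tail_inc _ _ _ fun r hr => not_not.1 fun h' => h r hr h')
  lab_out j _ k hk k' := by
    rw [initialStage_lab hn, ← htail, ← hopp, φ.apply_eq_iff_eq, ProductDart.opp_eq_iff]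
    rintro (h | h) <;> cases h

section removal

variable (hl : ∀ σ ∈ l, σ.IsCycle) (hrot : ∀ d, φ d.rot = T.rot (φ d))
include hrot

theorem iterate_rot_map (m : ℕ) (d : ProductDart l) :
    φ (ProductDart.rot^[m] d) = T.rot^[m] (φ d) := by
  induction m with
  | zero => rfl
  | succ m ih => rw [Function.iterate_succ_apply', Function.iterate_succ_apply', hrot, ih]

include hl

theorem map_mem_star_iff {d d' : ProductDart l} : φ d' ∈ star (φ d) ↔ d'.vtx = d.vtx := by
  rw [eq_comm, ProductDart.vtx_eq_iff hl]
  refine exists_congr fun m => ?_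
  rw [← iterate_rot_map hrot, φ.apply_eq_iff_eq]

theorem ncard_star {d : ProductDart l} {i : Fin l.length} (hd : d.vtx = .inr i) :
    (star (φ d)).ncard = 2 * (l.get i).support.card := by
  have : star (φ d) = φ '' {d' | d'.vtx = .inr i} := by
    ext e
    obtain ⟨d', rfl⟩ := φ.surjective e
    rw [map_mem_star_iff hl hrot, hd, φ.injective.mem_set_image]
    rfl
  rw [this, Set.ncard_image_of_injective _ φ.injective, ← ProductDart.card_vtx_eq]
  rfl

namespace Stripped

variable {s : Stage n T} {G : Set (Fin l.length)} (h : Stripped φ s G)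
include h

/-- Outgoing half-edges never lead to t-leaves, so half of the star carrying labels means that every
incoming half-edge does, that is, that all predecessors are gone. -/
theorem removable_iff (d : ProductDart l) :
    s.Removable (φ d) ↔ ∃ i, d.vtx = .inr i ∧ Ready G i := by
  have key : ∀ i, d.vtx = .inr i → d.rot ≠ d → (s.Removable (φ d) ↔ Ready G i) := by
    intro i hi hr
    have hgone : φ d ∉ s.gone ↔ i ∉ G := by
      rw [h.gone, hi]
      simp
    have hr' : T.rot (φ d) ≠ φ d := fun h => hr (φ.injective (by rw [hrot, h]))
    rw [Stage.Removable, Ready, hgone]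
    refine and_congr_right fun hiG => ?_
    let B : Set {k // l.get i k ≠ k} := {k | ∀ r, r < i → l.get r k.1 ≠ k.1 → r ∈ G}
    have hB : {e | e ∈ star (φ d) ∧ ∃ k, s.lab e k} =
        (fun k : {k // l.get i k ≠ k} => φ (.inc i k.1 k.2)) '' B := by
      ext e
      obtain ⟨d', rfl⟩ := φ.surjective e
      constructor
      · rintro ⟨h1, k, hk⟩
        rw [map_mem_star_iff hl hrot, hi] at h1
        cases d' with
        | tail => cases h1
        | head => cases h1
        | inc j k' hk' =>
          obtain rfl : j = i := Sum.inr.inj h1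
          exact ⟨⟨k', hk'⟩, ((h.lab_inc j hiG k' hk' k).1 hk).2, rfl⟩
        | out j k' hk' =>
          obtain rfl : j = i := Sum.inr.inj h1
          exact absurd hk (h.lab_out j hiG k' hk' k)
      · rintro ⟨k, hk, h1⟩
        rw [← h1]
        exact ⟨(map_mem_star_iff hl hrot).2 hi.symm, k.1, (h.lab_inc i hiG _ _ _).2 ⟨rfl, hk⟩⟩
    have hinj : Function.Injective fun k : {k // l.get i k ≠ k} => φ (.inc i k.1 k.2) :=
      fun a b hab => Subtype.ext (ProductDart.inc.inj (φ.injective hab)).2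
    rw [hB, Set.ncard_image_of_injective _ hinj, ncard_star hl hrot hi]
    have hcard : Nat.card {k // l.get i k ≠ k} = (l.get i).support.card := by
      rw [Nat.card_eq_fintype_card, ProductDart.card_moved]
    constructor
    · rintro ⟨-, j, hj, hBj⟩
      have hBu : B = Set.univ := by
        rw [Set.eq_univ_iff_ncard, hcard]; omega
      intro k hk
      exact (Set.ext_iff.1 hBu ⟨k, hk⟩).2 trivial
    · intro hready
      have hBu : B = Set.univ := Set.eq_univ_of_forall fun k => hready k.1 k.2
      exact ⟨hr', _, rfl, by rw [(Set.eq_univ_iff_ncard _).1 hBu, hcard]⟩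
  have key' : ∀ i, d.vtx = .inr i → d.rot ≠ d →
      (s.Removable (φ d) ↔ ∃ i, d.vtx = .inr i ∧ Ready G i) := by
    intro i hi hr
    rw [key i hi hr, hi]
    simp
  cases d with
  | tail k =>
    exact ⟨fun h => absurd (hrot (.tail k)).symm h.2.1, by rintro ⟨i, hi, -⟩; cases hi⟩
  | head k =>
    exact ⟨fun h => absurd (hrot (.head k)).symm h.2.1, by rintro ⟨i, hi, -⟩; cases hi⟩
  | inc i k hk => exact key' i rfl (ProductDart.rot_inc_ne i k hk)
  | out i k hk => exact key' i rfl (ProductDart.rot_out_ne i k hk)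

theorem isFactor_iff {d : ProductDart l} {i : Fin l.length} (hd : d.vtx = .inr i)
    (hi : Ready G i) (σ : Equiv.Perm (Fin n)) : s.IsFactor (φ d) σ ↔ σ = l.get i := by
  have hlab : ∀ k hk k', s.lab (φ (.inc i k hk)) k' ↔ k' = k := fun k hk k' => by
    rw [h.lab_inc i hi.1, and_iff_left (hi.2 k hk)]
  have hstar : ∀ e ∈ star (φ d), ∀ k, s.lab e k → ∃ hk, e = φ (.inc i k hk) := by
    intro e he k hk
    obtain ⟨d', rfl⟩ := φ.surjective e
    rw [map_mem_star_iff hl hrot, hd] at he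
    cases d' with
    | tail => cases he
    | head => cases he
    | inc j k' hk' =>
      obtain rfl : j = i := Sum.inr.inj he
      obtain rfl := (hlab k' hk' k).1 hk
      exact ⟨hk', rfl⟩
    | out j k' hk' =>
      obtain rfl : j = i := Sum.inr.inj he
      exact absurd hk (h.lab_out j hi.1 k' hk' k)
  have hone : ∀ k hk k', ¬ s.lab (T.rot^[1] (φ (.inc i k hk))) k' := by
    intro k hk k'
    rw [← iterate_rot_map hrot]
    exact h.lab_out i hi.1 _ _ _
  have htwo : ∀ k hk k', s.lab (T.rot^[2] (φ (.inc i k hk))) k' ↔ k' = l.get i k := by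
    intro k hk k'
    rw [← iterate_rot_map hrot]
    exact hlab _ _ _
  constructor
  · rintro ⟨h1, h2⟩
    ext k : 1
    by_cases hk : l.get i k = k
    · rw [hk]
      refine h2 k fun e he hek => ?_
      obtain ⟨hk', -⟩ := hstar e he k hek
      exact hk' hk
    · obtain ⟨r, hr1, hr2, hr3⟩ := h1 (φ (.inc i k hk)) ((map_mem_star_iff hl hrot).2 hd.symm) k
        ((hlab k hk k).2 rfl)
      -- Incoming and outgoing half-edges alternate and only the incoming ones carry labels, so the
      -- next label is exactly two turns away.
      have hr : r = 2 := by
        have h3 : r ≠ 1 := by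
          rintro rfl
          exact hone _ _ _ hr2
        by_contra h4
        exact hr3 2 (by omega) (by omega) _ ((htwo k hk _).2 rfl)
      subst hr
      exact (htwo k hk _).1 hr2
  · rintro rfl
    refine ⟨fun e he k hek => ?_, fun k hk => ?_⟩
    · obtain ⟨hk, rfl⟩ := hstar e he k hek
      refine ⟨2, by omega, (htwo k hk _).2 rfl, fun q hq hq' k' => ?_⟩
      obtain rfl : q = 1 := by omega
      exact hone k hk k'
    · by_contra hk'
      exact hk (φ (.inc i k hk')) ((map_mem_star_iff hl hrot).2 hd.symm) ((hlab k hk' k).2 rfl)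

/-- Cutting the edge from outgoing k at the removed vertex passes on the label of the half-edge that
follows it there, which is incoming k; so the next factor on the path k receives the label k. -/
theorem remove (hopp : ∀ d, φ d.opp = opp (φ d)) {d : ProductDart l} {i : Fin l.length}
    (hd : d.vtx = .inr i) (hi : Ready G i) : Stripped φ (s.remove (φ d)) (insert i G) := by
  have hmem : ∀ d', φ d' ∈ star (φ d) ↔ d'.vtx = .inr i := fun d' => by
    rw [map_mem_star_iff hl hrot, hd]
  have hlab : ∀ d' k, (s.remove (φ d)).lab (φ d') k ↔
      (d'.opp.vtx = .inr i ∧ s.lab (φ d'.opp.rot) k) ∨ (d'.opp.vtx ≠ .inr i ∧ s.lab (φ d') k) := by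
    intro d' k
    simp only [Stage.remove, ← hopp, hmem, ← hrot]
  refine ⟨fun d' => ?_, fun i' j k hij hi' hj hjG => ?_, fun j hj k hk k' => ?_,
    fun j hj k hk k' => ?_⟩
  · simp only [Stage.remove, Set.mem_union, h.gone, hmem, Set.mem_insert_iff, exists_eq_or_imp]
    exact or_comm
  · rcases hjG with rfl | hjG
    · exact .inr (hi.2 k hj i' hij hi')
    · exact .inr (h.closed i' j k hij hi' hj hjG)
  · have hjG : j ∉ G := fun h => hj (.inr h)
    have hji : j ≠ i := fun h => hj (.inl h)
    rw [hlab, h.lab_inc j hjG]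
    rcases ProductDart.opp_spec (.inc j k hk) with ha | ha
    · cases ha
    · generalize ProductDart.opp (.inc j k hk) = d' at ha
      cases ha with
      | tail_inc _ _ _ hfix =>
        have : ∀ {P : Fin l.length → Prop}, ∀ r, r < j → l.get r k ≠ k → P r :=
          fun r hr hr' => absurd (hfix r hr) hr'
        simp only [ProductDart.vtx, reduceCtorEq, false_and, false_or, ne_eq, not_false_eq_true,
          true_and]
        exact and_congr_right fun _ => ⟨fun _ => this, fun _ => this⟩
      | out_inc i' _ _ hi' _ hij hfix =>
        simp only [ProductDart.vtx, Sum.inr.injEq, ProductDart.rot]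
        by_cases hii : i' = i
        · subst hii
          rw [h.lab_inc i' hi.1]
          simp only [true_and, ne_eq, not_true_eq_false, false_and, or_false]
          refine and_congr_right fun _ => ⟨fun h1 r hr hr' => ?_, fun _ => hi.2 k hi'⟩
          rcases lt_trichotomy r i' with hlt | rfl | hlt
          · exact .inr (h1 r hlt hr')
          · exact .inl rfl
          · exact absurd (hfix r hlt hr) hr'
        · simp only [Sum.inr.injEq, hii, false_and, false_or, ne_eq, not_false_eq_true, true_and]
          refine and_congr_right fun _ => ⟨fun h1 r hr hr' => .inr (h1 r hr hr'),
            fun h1 r hr hr' => (h1 r hr hr').resolve_left ?_⟩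
          -- If the removed factor came before the direct predecessor i', closedness of `G` would
          -- have forced it to be gone already.
          rintro rfl
          have hlt : r < i' := by
            rcases lt_trichotomy r i' with h2 | h2 | h2
            · exact h2
            · exact absurd h2.symm hii
            · exact absurd (hfix r h2 hr) hr'
          have := (h1 i' hij hi').resolve_left hii
          exact hi.1 (h.closed r i' k hlt hr' hi' this)
  · have hjG : j ∉ G := fun h => hj (.inr h)
    have hji : j ≠ i := fun h => hj (.inl h)
    rw [hlab]
    rintro (⟨h1, -⟩ | ⟨-, h1⟩)
    · have ha := ProductDart.opp_spec (.out j k hk)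
      generalize ProductDart.opp (.out j k hk) = d' at ha h1
      rcases ha with ha | ha
      · cases ha with
        | out_inc _ j' _ _ hj' hij hfix =>
          obtain rfl : j' = i := Sum.inr.inj h1
          -- An outgoing half-edge into the removed factor would belong to an earlier factor moving
          -- k, which is already gone.
          exact hjG (hi.2 k hj' j hij hk)
        | out_head => cases h1
      · cases ha
    · exact h.lab_out j hjG k hk k' h1

end Stripped

end removal

/-! ### Runs of the stripping procedure -/

open Classical in
/-- The factors whose indices are not in `G`. -/
noncomputable def remaining (G : Set (Fin l.length)) : List (Equiv.Perm (Fin n)) :=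
  ((List.finRange l.length).filter fun i => i ∉ G).map l.get

theorem remaining_empty : remaining (∅ : Set (Fin l.length)) = l := by
  simp [remaining]

theorem remaining_univ : remaining (Set.univ : Set (Fin l.length)) = [] := by
  simp [remaining]

/-- An earlier remaining factor that shared a label with the ready one would have to be in `G`. So
all of them are disjoint from it, and it can be moved to the front. -/
theorem eqvGen_remaining {G : Set (Fin l.length)} {i : Fin l.length} (hi : Ready G i) :
    Relation.EqvGen CommutationMove (remaining G) (l.get i :: remaining (insert i G)) := by
  classical
  have hmem : i ∈ (List.finRange l.length).filter fun i => i ∉ G := by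
    simpa using hi.1
  have hsorted : ((List.finRange l.length).filter fun i => i ∉ G).Pairwise (· < ·) :=
    (List.pairwise_lt_finRange _).filter _
  obtain ⟨a, b, hab⟩ := List.append_of_mem hmem
  have hins : ((List.finRange l.length).filter fun j => j ∉ insert i G) = a ++ b := by
    have : ((List.finRange l.length).filter fun j => j ∉ insert i G) =
        ((List.finRange l.length).filter fun i => i ∉ G).filter fun j => j ≠ i := by
      rw [List.filter_filter]
      congr 1
      ext j
      simp [Set.mem_insert_iff]
    rw [this, hab]
    rw [hab, List.pairwise_append, List.pairwise_cons] at hsorted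
    rw [List.filter_append, List.filter_cons_of_neg (by simp), List.filter_eq_self.2,
      List.filter_eq_self.2]
    · intro j hj
      simpa using (hsorted.2.1.1 j hj).ne'
    · intro j hj
      simpa using (hsorted.2.2 j hj i List.mem_cons_self).ne
  have hrem : remaining (insert i G) = (a ++ b).map l.get := by
    rw [remaining, ← hins]
    congr!
  rw [hrem, remaining, hab, List.map_append, List.map_append, List.map_cons]
  refine eqvGen_commutationMove_middle _ _ _ fun τ hτ => ?_
  obtain ⟨j, hj, rfl⟩ := List.mem_map.1 hτ
  have hjG : j ∉ G := by
    have : j ∈ (List.finRange l.length).filter fun i => i ∉ G := by rw [hab]; simp [hj]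
    simpa using this
  rw [hab, List.pairwise_append] at hsorted
  have hji : j < i := hsorted.2.2 j hj i List.mem_cons_self
  refine Equiv.Perm.Disjoint.commute fun k => ?_
  by_contra! hk
  exact hjG (hi.2 k hk.2 j hji hk.1)

section run

variable (hl : ∀ σ ∈ l, σ.IsCycle) (hrot : ∀ d, φ d.rot = T.rot (φ d))
  (hopp : ∀ d, φ d.opp = opp (φ d))
include hl hrot

theorem Stripped.complete_iff {s : Stage n T} {G : Set (Fin l.length)} (h : Stripped φ s G) :
    s.Complete ↔ G = Set.univ := by
  constructor
  · intro hs
    refine Set.eq_univ_of_forall fun i => ?_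
    obtain ⟨k, hk, -⟩ := hl _ (l.get_mem i)
    have h1 := hs (φ (.inc i k hk)) (by
      rw [← hrot]; exact fun h => ProductDart.rot_inc_ne i k hk (φ.injective h))
    obtain ⟨j, hj, hji⟩ := (h.gone _).1 h1
    obtain rfl : i = j := Sum.inr.inj hji
    exact hj
  · rintro rfl e he
    obtain ⟨d, rfl⟩ := φ.surjective e
    rw [h.gone]
    cases d with
    | tail k => exact absurd (hrot (.tail k)).symm he
    | head k => exact absurd (hrot (.head k)).symm he
    | inc i k hk => exact ⟨i, trivial, rfl⟩
    | out i k hk => exact ⟨i, trivial, rfl⟩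

include hopp

/-- Whatever choices are made, the factors read off followed by those still present stay equivalent
to the list at the start. -/
theorem Stripped.run {s s' : Stage n T} {G : Set (Fin l.length)} (h : Stripped φ s G)
    {l' : List (Equiv.Perm (Fin n))} (hrun : Stage.Run s l' s') :
    ∃ G', Stripped φ s' G' ∧
      Relation.EqvGen CommutationMove (remaining G) (l' ++ remaining G') := by
  induction hrun generalizing G with
  | nil s => exact ⟨G, h, .refl _⟩
  | cons s s' e σ l' he hσ _ ih =>
    obtain ⟨d, rfl⟩ := φ.surjective e
    obtain ⟨i, hd, hi⟩ := (h.removable_iff hl hrot d).1 he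
    obtain rfl := (h.isFactor_iff hl hrot hd hi σ).1 hσ
    obtain ⟨G', h1, h2⟩ := ih (h.remove hl hrot hopp hd hi)
    exact ⟨G', h1, .trans _ _ _ (eqvGen_remaining hi) (eqvGen_commutationMove_cons _ h2)⟩

/-- When the first p factors are gone, the next one is ready; so the list itself can be read off in
its own order. -/
theorem Stripped.exists_run {p : ℕ} (hp : p ≤ l.length) {s : Stage n T}
    (h : Stripped φ s {i : Fin l.length | (i : ℕ) < p}) :
    ∃ s', Stage.Run s (l.drop p) s' ∧ s'.Complete := by
  induction hp using Nat.decreasingInduction generalizing s with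
  | self =>
    refine ⟨s, by rw [List.drop_length]; exact .nil s, (h.complete_iff hl hrot).2 ?_⟩
    exact Set.eq_univ_of_forall fun i => i.2
  | @of_succ p hp ih =>
    obtain ⟨k, hk, -⟩ := hl _ (l.get_mem ⟨p, hp⟩)
    have hready : Ready {i : Fin l.length | (i : ℕ) < p} ⟨p, hp⟩ :=
      ⟨lt_irrefl p, fun _ _ r hr _ => hr⟩
    have hd : (ProductDart.inc ⟨p, hp⟩ k hk : ProductDart l).vtx = .inr ⟨p, hp⟩ := rfl
    have h1 := h.remove hl hrot hopp hd hready
    have h2 : insert ⟨p, hp⟩ {i : Fin l.length | (i : ℕ) < p} =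
        {i : Fin l.length | (i : ℕ) < p + 1} := by
      ext i
      simp only [Set.mem_insert_iff, Set.mem_ofPred_eq, Fin.ext_iff]
      omega
    rw [h2] at h1
    obtain ⟨s', hs', hc⟩ := ih h1
    refine ⟨s', ?_, hc⟩
    rw [List.drop_eq_getElem_cons hp]
    exact .cons _ _ _ _ _ ((h.removable_iff hl hrot _).2 ⟨_, hd, hready⟩)
      ((h.isFactor_iff hl hrot hd hready _).2 rfl) hs'

end run

end strip

/-! ### Stripping as the inverse -/

section stripping

variable {n : ℕ} [NeZero n] {α : ℕ →₀ ℕ} {l : List (Equiv.Perm (Fin n))} {T : PlantedTree}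

theorem IsTreeOfProduct.exists_stripped (h : T.IsTreeOfProduct l)
    (hl : IsMinimalFactorization n α l) : ∃ φ : ProductDart l ≃ T.Dart,
      (∀ d, φ d.rot = T.rot (φ d)) ∧ (∀ d, φ d.opp = opp (φ d)) ∧
        Stripped φ (initialStage n T) ∅ := by
  obtain ⟨φ, hrot, hopp, hroot⟩ := isTreeOfProduct_iff.1 h
  have hn := h.vertexCount_one hl.isCycle
  exact ⟨φ, hrot, hopp, stripped_initialStage hn hopp fun k =>
    (headDart_eq_tailDart_eq hn hl.prod_eq hrot hopp hroot k).2⟩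

/-- The stripping procedure applied to the tree of a minimal factorization. -/
theorem IsTreeOfProduct.run (h : T.IsTreeOfProduct l) (hl : IsMinimalFactorization n α l)
    {l' : List (Equiv.Perm (Fin n))} {s : Stage n T}
    (hrun : Stage.Run (initialStage n T) l' s) :
    (¬ s.Complete → ∃ d, s.Removable d) ∧ (∀ d, s.Removable d → ∃ σ, s.IsFactor d σ) ∧
      (s.Complete → Relation.EqvGen CommutationMove l l') := by
  obtain ⟨φ, hrot, hopp, hstrip⟩ := h.exists_stripped hl
  obtain ⟨G, hG, heqv⟩ := hstrip.run hl.isCycle hrot hopp hrun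
  rw [remaining_empty] at heqv
  have hcomplete := hG.complete_iff hl.isCycle hrot
  refine ⟨fun hs => ?_, fun e he => ?_, fun hs => ?_⟩
  · obtain ⟨i, hi⟩ := exists_ready fun h => hs (hcomplete.2 h)
    obtain ⟨k, hk, -⟩ := hl.isCycle _ (l.get_mem i)
    exact ⟨φ (.inc i k hk), (hG.removable_iff hl.isCycle hrot _).2 ⟨i, rfl, hi⟩⟩
  · obtain ⟨d, rfl⟩ := φ.surjective e
    obtain ⟨i, hd, hi⟩ := (hG.removable_iff hl.isCycle hrot d).1 he
    exact ⟨_, (hG.isFactor_iff hl.isCycle hrot hd hi _).2 rfl⟩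
  · rw [hcomplete.1 hs, remaining_univ, List.append_nil] at heqv
    exact heqv

theorem IsTreeOfProduct.exists_run (h : T.IsTreeOfProduct l) (hl : IsMinimalFactorization n α l) :
    ∃ s, Stage.Run (initialStage n T) l s ∧ s.Complete := by
  obtain ⟨φ, hrot, hopp, hstrip⟩ := h.exists_stripped hl
  have h0 : {i : Fin l.length | (i : ℕ) < 0} = ∅ := by simp
  exact Stripped.exists_run (p := 0) hl.isCycle hrot hopp (Nat.zero_le _) (h0 ▸ hstrip)

/-- Minimal factorizations with the same tree are equivalent. -/
theorem IsTreeOfProduct.eqvGen (h : T.IsTreeOfProduct l) (hl : IsMinimalFactorization n α l)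
    {l' : List (Equiv.Perm (Fin n))} (h' : T.IsTreeOfProduct l')
    (hl' : IsMinimalFactorization n α l') : Relation.EqvGen CommutationMove l l' := by
  -- The tree can be stripped to give l' exactly. Seen as the tree of l, any complete stripping of
  -- it gives a list equivalent to l.
  obtain ⟨s, hrun, hs⟩ := h'.exists_run hl'
  exact (h.run hl hrun).2.2 hs

end stripping

end PlantedTree

/-- Sending a factorization to the plane tree of its product, rooted at the leaf `h₀`, is a bijection
from the equivalence classes of minimal factorizations of type `α` onto the plane trees of type
`α` rooted at a leaf. Its inverse is the stripping procedure: whatever choices have been made, the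
procedure can be continued until no internal vertex is left, and then the cycles that have been
read off form a factorization in the class that corresponds to the tree. -/
theorem theorem1 (n : ℕ) [NeZero n] (α : ℕ →₀ ℕ) :
    ∃ Φ : InequivalentFactorization n α ≃ {T : PlantedTree // T.HasType n α},
      (∀ (l : MinimalFactorization n α) (T : {T : PlantedTree // T.HasType n α}),
        Φ (Quotient.mk (factorizationSetoid n α) l) = T ↔ T.1.IsTreeOfProduct l.1) ∧
      (∀ T : {T : PlantedTree // T.HasType n α}, ∀ l s,
        PlantedTree.Stage.Run (PlantedTree.initialStage n T.1) l s →
          (¬ s.Complete → ∃ d, s.Removable d) ∧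
          (∀ d, s.Removable d → ∃ σ, s.IsFactor d σ) ∧
          (s.Complete → ∃ hl : IsMinimalFactorization n α l,
            Φ.symm T = Quotient.mk (factorizationSetoid n α) ⟨l, hl⟩)) := by
  choose tree htree using fun l : MinimalFactorization n α => l.2.exists_isTreeOfProduct
  let F : InequivalentFactorization n α → {T : PlantedTree // T.HasType n α} :=
    Quotient.lift (fun l => ⟨tree l, (htree l).hasType l.2⟩) fun l l' h =>
      Subtype.ext ((((Relation.EqvGen.commutationMove h).2 l.2 _).1 (htree l)).unique (htree l'))
  have hF : ∀ (l : MinimalFactorization n α) (T : {T : PlantedTree // T.HasType n α}),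
      F (Quotient.mk _ l) = T ↔ T.1.IsTreeOfProduct l.1 := fun l T =>
    ⟨fun h => h ▸ htree l, fun h => Subtype.ext ((htree l).unique h)⟩
  have hbij : Function.Bijective F := by
    constructor
    · intro x y
      induction x using Quotient.inductionOn with | _ l => ?_
      induction y using Quotient.inductionOn with | _ l' => ?_
      intro h
      have h1 := (hF l (F (Quotient.mk _ l'))).1 h
      have h2 := (hF l' (F (Quotient.mk _ l'))).1 rfl
      exact Quotient.sound (h1.eqvGen l.2 h2 l'.2)
    · intro T
      obtain ⟨l, hl, hT⟩ := T.2.exists_isTreeOfProduct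
      exact ⟨Quotient.mk _ ⟨l, hl⟩, (hF ⟨l, hl⟩ T).2 hT⟩
  refine ⟨Equiv.ofBijective F hbij, hF, fun T l s hrun => ?_⟩
  -- Any factorization with this tree serves as a reference; the run is compared with it, and
  -- minimality and the tree transfer along the equivalence.
  obtain ⟨l₀, hl₀, hT⟩ := T.2.exists_isTreeOfProduct
  have h := hT.run hl₀ hrun
  refine ⟨h.1, h.2.1, fun hs => ?_⟩
  have heqv := h.2.2 hs
  have hl : IsMinimalFactorization n α l := (Relation.EqvGen.commutationMove heqv).1.1 hl₀
  refine ⟨hl, (Equiv.symm_apply_eq _).2 ((hF ⟨l, hl⟩ T).2 ?_).symm⟩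
  exact ((Relation.EqvGen.commutationMove heqv).2 hl₀ T.1).1 hT
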